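/- \textbf{Theorem 2 (multi-stream transmission capacity).} Let $1\le K\le M$ and $B\ge 0$ be integers, $\alpha>2$, $\rho>0$, $\sigma^2\ge 0$, $\beta>0$ and $\varepsilon\in(0,1)$. A typical transmitter with $M$ antennas at the origin of $\mathbb R^2$ sends $K$ streams, one to each of $K$ single-antenna users; user $k$ is at distance $d_k>0$ from it. The other transmitters form a homogeneous Poisson point process of intensity $\lambda\ge 0$ in $\mathbb R^2$, and each of them also sends $K$ streams. Each stream has power $\rho$, the noise variance is $\sigma^2$, and power decays with distance $d$ as $d^{-\alpha}$. With zero-forcing from $B$ bits of feedback per user, the SINR of user $k$ is $$\mathrm{SINR}_k=\frac{\rho\, g_{kk}\,d_k^{-\alpha}}{\sum_i \rho\big(\sum_{j=1}^K g^{(i)}_{kj}\big)D_{ik}^{-\alpha}+\sum_{j\ne k}\rho\, g_{kj}\,d_k^{-\alpha}+\sigma^2},$$ where $D_{ik}$ is the distance from interferer $i$ to user $k$, and $g_{kj}$ and $g^{(i)}_{kj}$ are the power gains at user $k$ of stream $j$ of the typical transmitter and of interferer $i$. For each user, all these gains are independent of one another and of the Poisson process, with the following laws. (i) $g_{kk}$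 and all $g_{kj}^{(i)}$ have the law of $|hw|^2$, where the row vector $h\in\mathbb C^{M}$ has i.i.d. $\mathcal{CN}(0,1)$ entries and $w\in\mathbb C^M$ is an independent isotropic unit vector. (ii) For $j\ne k$, $g_{kj}$ has the law of the leakage $\|h\|^2\sin^2\!\varphi\,|vw|^2$ of a beam orthogonal to the quantized channel direction, under the quantization cell approximation: $h$ is as in (i); $\sin^2\varphi$ has distribution function $2^Bx^{M-1}$ on $[0,\delta]$, with $\delta=2^{-B/(M-1)}$; $v,w$ are isotropic unit vectors of $\mathbb C^{M-1}$; and $h,\varphi,v,w$ are independent. Let $$\lambda_\varepsilon=\sup\{\lambda\ge 0:\ \mathbb P(\mathrm{SINR}_k\le\beta)\le\varepsilon\ \text{ for all } k\},\qquad \mathcal C=K\lambda_\varepsilon(1-\varepsilon)$$ be the maximum contention density and the multi-stream transmission capacity. Put $\zeta_{\max}=\beta\,(\max_k d_k)^\alpha$ and $$\mathcal I_K=\frac{2\pi}{\alpha}\sum_{m=0}^{K-1}\binom Km \mathrm B\!\left(m+\tfrac2\alpha,\,K-m-\tfrac2\alpha\right),$$ with $\mathrm B$ the Beta function. If the outage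 constraint is feasible, that is, if $$\log\frac1{1-\varepsilon}-\frac{\sigma^2\zeta_{\max}}{\rho}-(K-1)\log(1+\beta\delta)\ \ge\ 0,$$ then the supremum $\lambda_\varepsilon$ is finite and attained, and $$\mathcal C=\frac{K(1-\varepsilon)}{\mathcal I_K\,\zeta_{\max}^{2/\alpha}}\left(\log\frac1{1-\varepsilon}-\frac{\sigma^2\zeta_{\max}}{\rho}-(K-1)\log(1+\beta\delta)\right).$$ (For $K=1$ the terms with $K-1$ and the gains in (ii) are absent.) -/

import Mathlib

open MeasureTheory ProbabilityTheory
open scoped ENNReal NNReal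

noncomputable section

/-- The Euclidean plane. -/
abbrev Plane : Type := EuclideanSpace ℝ (Fin 2)

/-! ### Poisson point processes -/

/-- The number of points of the family `X` (in the outcome `ω`) that lie in `A`. -/
def pointCount {Ω ι : Type} (X : ι → Ω → Plane) (A : Set Plane) (ω : Ω) : ℕ∞ :=
  {i | X i ω ∈ A}.encard

/-- The points `X i` form a homogeneous Poisson point process of intensity `lam` in the plane: the
number of points in a set of finite area is Poisson with mean `lam * area`, and the numbers of
points in disjoint sets are independent. (For `lam = 0` there are no points, and the index type is
empty.) -/
structure IsPoissonProcess {Ω ι : Type} [MeasurableSpace Ω] (X : ι → Ω → Plane) (lam : ℝ≥0)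
    (μ : Measure Ω) : Prop where
  measurable : ∀ i, Measurable (X i)
  count_law : ∀ A : Set Plane, MeasurableSet A → volume A ≠ ∞ →
    HasLaw (pointCount X A)
      ((poissonMeasure (lam * (volume A).toNNReal)).map (fun n : ℕ => (n : ℕ∞))) μ
  count_indep : ∀ (n : ℕ) (A : Fin n → Set Plane), (∀ j, MeasurableSet (A j)) →
    Pairwise (fun i j => Disjoint (A i) (A j)) → iIndepFun (fun j => pointCount X (A j)) μ

/-! ### Channels, quantization and stream gains -/

/-- The law `CN(0,1)`: independent real and imaginary parts, both `N(0,1/2)`. -/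
def stdComplexGaussian : Measure ℂ :=
  ((gaussianReal 0 (1 / 2)).prod (gaussianReal 0 (1 / 2))).map
    (fun p : ℝ × ℝ => (p.1 : ℂ) + (p.2 : ℂ) * Complex.I)

/-- The law of a vector of `n` i.i.d. `CN(0,1)` entries (Rayleigh fading). -/
def rayleighVector (n : ℕ) : Measure (Fin n → ℂ) :=
  Measure.pi (fun _ => stdComplexGaussian)

/-- The squared Euclidean norm `‖h‖²`. -/
def sqNorm {n : ℕ} (h : Fin n → ℂ) : ℝ := ∑ m, ‖h m‖ ^ 2

/-- The power `|h w|²` of the product of the row vector `h` and the column vector `w`. -/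
def beamGain {n : ℕ} (h w : Fin n → ℂ) : ℝ := ‖∑ m, h m * w m‖ ^ 2

/-- The law of an isotropic (uniformly distributed) unit vector of `ℂⁿ`: the direction of a vector
of i.i.d. `CN(0,1)` entries. -/
def isotropicUnitVector (n : ℕ) : Measure (Fin n → ℂ) :=
  (rayleighVector n).map (fun g m => g m / (Real.sqrt (sqNorm g) : ℂ))

/-- The law of `|h w|²` for a Rayleigh channel vector `h` in `ℂᴹ` and an independent isotropic unit
beamforming vector `w`. -/
def unmatchedGainLaw (M : ℕ) : Measure ℝ :=
  ((rayleighVector M).prod (isotropicUnitVector M)).map (fun p => beamGain p.1 p.2)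

/-- `δ = 2^{-B/(M-1)}`. -/
def quantDelta (M B : ℕ) : ℝ := (2 : ℝ) ^ (-(B : ℝ) / ((M : ℝ) - 1))

/-- The law of the quantization error `sin² φ` (with `φ` the angle between the channel and its
quantized direction) in the quantization cell approximation with `B` bits and `M ≥ 2` antennas: its
distribution function is `2^B x^{M-1}` for `0 ≤ x ≤ δ`. -/
def quantErrorLaw (M B : ℕ) : Measure ℝ :=
  (volume.restrict (Set.Icc 0 (quantDelta M B))).withDensity
    (fun x => ENNReal.ofReal (2 ^ B * ((M : ℝ) - 1) * x ^ (M - 2)))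

/-- The law of the leakage `|h w|²` from a zero-forcing beam `w` that is orthogonal to the quantized
direction `ĥ` of the channel `h`. Decompose `h = ‖h‖ (cos φ ĥ + sin φ v)` with `v` a unit vector
orthogonal to `ĥ`; since `ĥ w = 0`, the leakage is `‖h‖² sin² φ |v w|²`. Here `h` is Rayleigh in
`ℂᴹ`, `sin² φ` follows the quantization cell approximation, `v` and `w` are isotropic unit vectors
of the hyperplane orthogonal to `ĥ`, which is a copy of `ℂᴹ⁻¹`, and all are independent. -/
def leakageGainLaw (M B : ℕ) : Measure ℝ :=
  ((rayleighVector M).prod ((quantErrorLaw M B).prod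
      ((isotropicUnitVector (M - 1)).prod (isotropicUnitVector (M - 1))))).map
    (fun p => sqNorm p.1 * p.2.1 * beamGain p.2.2.1 p.2.2.2)

/-- The law of the gain at the typical user `k` of the stream `j` of the typical transmitter
(`none`) or of the interfering transmitter `i` (`some i`). The beams of the interferers and the
user's own beam are chosen without regard to the channel vector they are received through; the
other beams of the typical transmitter are zero-forced against the quantized channel of `k`. -/
def streamGainLaw (M B : ℕ) {K : ℕ} {ι : Type} (k : Fin K) : Option ι × Fin K → Measure ℝ
  | (none, j) => if j = k then unmatchedGainLaw M else leakageGainLaw M B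
  | (some _, _) => unmatchedGainLaw M

/-! ### The network -/

/-- A random access network of transmitters with `M` antennas that send `K` streams each, using
zero-forcing with `B` bits of feedback per user, seen from a typical transmitter at the origin,
whose users are located at `r k`. The other transmitters form a Poisson point process of intensity
`lam`; all stream gains at a user are independent of each other and of the point process. -/
structure ZFNetwork (M K B : ℕ) (r : Fin K → Plane) (lam : ℝ≥0) where
  /-- Sample space. -/
  Ω : Type
  [mΩ : MeasurableSpace Ω]
  /-- Probability. -/
  μ : Measure Ω
  [prob : IsProbabilityMeasure μ]
  /-- Labels of the interfering transmitters. -/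
  ι : Type
  [countable_ι : Countable ι]
  /-- Locations of the interfering transmitters. -/
  X : ι → Ω → Plane
  /-- `gain k (none, j)`: power gain at user `k` of stream `j` of the typical transmitter;
  `gain k (some i, j)`: power gain at user `k` of stream `j` of the interferer `i`. -/
  gain : Fin K → Option ι × Fin K → Ω → ℝ
  poisson : IsPoissonProcess X lam μ
  gain_law : ∀ k s, HasLaw (gain k s) (streamGainLaw M B k s) μ
  gain_indep : ∀ k, iIndepFun (gain k) μ
  gain_indep_points : ∀ k, IndepFun (fun ω s => gain k s ω) (fun ω i => X i ω) μ

namespace ZFNetwork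

attribute [instance] ZFNetwork.mΩ ZFNetwork.prob ZFNetwork.countable_ι

variable {M K B : ℕ} {r : Fin K → Plane} {lam : ℝ≥0}

/-- The received power of the intended stream, `ρ |h_k w_k|² d_k^{-α}` with `d_k = ‖r k‖`. -/
def signal (N : ZFNetwork M K B r lam) (α ρ : ℝ) (k : Fin K) (ω : N.Ω) : ℝ≥0∞ :=
  ENNReal.ofReal (ρ * N.gain k (none, k) ω * ‖r k‖ ^ (-α))

/-- The inter-cluster interference `∑_i ρ ‖h_{ik} W_i‖² D_i^{-α}`, where
`‖h_{ik} W_i‖² = ∑_j |h_{ik} w_{ij}|²` and `D_i` is the distance from the interferer `i` to the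
user `k`. -/
def interCluster (N : ZFNetwork M K B r lam) (α ρ : ℝ) (k : Fin K) (ω : N.Ω) : ℝ≥0∞ :=
  ∑' i, ENNReal.ofReal (ρ * (∑ j, N.gain k (some i, j) ω) * ‖N.X i ω - r k‖ ^ (-α))

/-- The intra-cluster self-interference `∑_{j ≠ k} ρ |h_k w_j|² d_k^{-α}`. -/
def intraCluster (N : ZFNetwork M K B r lam) (α ρ : ℝ) (k : Fin K) (ω : N.Ω) : ℝ≥0∞ :=
  ∑ j ∈ Finset.univ.erase k, ENNReal.ofReal (ρ * N.gain k (none, j) ω * ‖r k‖ ^ (-α))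

/-- The received SINR of user `k`, with noise variance `σ²`. -/
def sinr (N : ZFNetwork M K B r lam) (α ρ σ : ℝ) (k : Fin K) (ω : N.Ω) : ℝ≥0∞ :=
  N.signal α ρ k ω / (N.interCluster α ρ k ω + N.intraCluster α ρ k ω + ENNReal.ofReal (σ ^ 2))

/-- The outage probability `P(SINR_k ≤ β)` of user `k`. -/
def outage (N : ZFNetwork M K B r lam) (α ρ σ β : ℝ) (k : Fin K) : ℝ :=
  N.μ.real {ω | N.sinr α ρ σ k ω ≤ ENNReal.ofReal β}

end ZFNetwork

/-- The intensities for which no stream exceeds the outage level `ε`. -/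
def admissibleDensities {M K B : ℕ} {r : Fin K → Plane} (N : ∀ lam : ℝ≥0, ZFNetwork M K B r lam)
    (α ρ σ β ε : ℝ) : Set ℝ≥0 :=
  {lam | ∀ k, (N lam).outage α ρ σ β k ≤ ε}

/-- The maximum contention density `λ_ε`. -/
def maxContentionDensity {M K B : ℕ} {r : Fin K → Plane} (N : ∀ lam : ℝ≥0, ZFNetwork M K B r lam)
    (α ρ σ β ε : ℝ) : ℝ≥0 :=
  sSup (admissibleDensities N α ρ σ β ε)

/-- The multi-stream transmission capacity `K λ_ε (1 - ε)`. -/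
def transmissionCapacity {M K B : ℕ} {r : Fin K → Plane} (N : ∀ lam : ℝ≥0, ZFNetwork M K B r lam)
    (α ρ σ β ε : ℝ) : ℝ :=
  K * maxContentionDensity N α ρ σ β ε * (1 - ε)

/-! ### The constants of the formula -/

/-- `I_K = (2π/α) ∑_{m<K} (K choose m) B(m + 2/α, K - m - 2/α)`, with `B` the Beta function. -/
def interferenceConst (K : ℕ) (α : ℝ) : ℝ :=
  2 * Real.pi / α *
    ∑ m ∈ Finset.range K, (K.choose m : ℝ) * beta (m + 2 / α) (K - m - 2 / α)

/-- `ζ_max = β d_max^α`, with `d_max` the largest distance of a user to the typical transmitter. -/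
def zetaMax {K : ℕ} (r : Fin K → Plane) (α β : ℝ) : ℝ :=
  β * (⨆ k, ‖r k‖) ^ α

end

/-! Fix a user at distance `d` and put `ζ = β d^α`. Its own gain is a unit-mean exponential
variable, independent of everything else at that user. Dividing by the mean signal power turns `SINR
> β` into the event that this variable exceeds `Z`, which is `ζ/ρ` times interference plus noise. So
the success probability is `E e^{-Z}`, a Laplace transform that factorizes
(`measure_add_tsum_lt_ofReal`). The noise gives `e^{-σ²ζ/ρ}` and each of the `K - 1` leakage terms
gives `(1 + βδ)⁻¹`. By the Laplace functional of the Poisson process, the interferers give `exp(-λ ∫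
(1 - (1 + ζ|x|^{-α})^{-K}) dx) = exp(-λ I_K ζ^{2/α})` (`IsPoissonProcess.lintegral_expNeg`,
`lintegral_plane_interference`).

The leakage is exponential with mean `δ` by a chain of exponents
(`lintegral_exp_neg_leakageGainLaw`). Integrating out `‖h‖²`, a Gamma variable of shape `M`, gives a
power `-M`; integrating out the quantization error lowers it to `-(M-1)`. That is the Laplace
transform of a Gamma variable of shape `M - 1`, the squared norm of a Rayleigh vector with direction
`v`. Norm and direction being independent, they recombine into one complex Gaussian `g w`, which
leaves `(1 + tδ)⁻¹`.

Hence the outage probability is `1 - e^{-E}` with `E` affine in `λ` and increasing in `ζ`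
(`outage_eq`, `outageExponent_mono`). The farthest user is the binding one, and the admissible
intensities form an interval `[0, slack / D]`.

All sums live in `[0, ∞]`, with `e^{-∞} = 0`, so no almost sure finiteness of the interference is
needed. -/

noncomputable section

/-! ### The function `x ↦ e^{-x}` on `[0, ∞]` -/

/-- The function `e^{-x}` on `[0, ∞]`, with `e^{-∞} = 0`. -/
def expNeg (x : ℝ≥0∞) : ℝ≥0∞ := (EReal.exp x)⁻¹

lemma expNeg_zero : expNeg 0 = 1 := by simp [expNeg]

lemma expNeg_top : expNeg ∞ = 0 := by simp [expNeg]

lemma expNeg_add (x y : ℝ≥0∞) : expNeg (x + y) = expNeg x * expNeg y := by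
  unfold expNeg
  rw [EReal.coe_ennreal_add, EReal.exp_add, ENNReal.mul_inv]
  · left; simp
  · right; simp

lemma continuous_expNeg : Continuous expNeg :=
  (ENNReal.continuous_exp.comp continuous_coe_ennreal_ereal).inv

lemma measurable_expNeg : Measurable expNeg := continuous_expNeg.measurable

lemma expNeg_antitone : Antitone expNeg := fun x y h => by
  unfold expNeg
  gcongr
  exact EReal.coe_ennreal_le_coe_ennreal_iff.2 h

lemma expNeg_le_one (x : ℝ≥0∞) : expNeg x ≤ 1 := by
  rw [← expNeg_zero]; exact expNeg_antitone (zero_le)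

lemma expNeg_ne_top (x : ℝ≥0∞) : expNeg x ≠ ∞ :=
  ((expNeg_le_one x).trans_lt ENNReal.one_lt_top).ne

lemma expNeg_ofReal {x : ℝ} (hx : 0 ≤ x) :
    expNeg (ENNReal.ofReal x) = ENNReal.ofReal (Real.exp (-x)) := by
  unfold expNeg
  rw [EReal.coe_ennreal_ofReal, max_eq_left hx, EReal.exp_coe, Real.exp_neg,
    ENNReal.ofReal_inv_of_pos (Real.exp_pos x)]

lemma expNeg_sum {S : Type*} (s : Finset S) (f : S → ℝ≥0∞) :
    expNeg (∑ i ∈ s, f i) = ∏ i ∈ s, expNeg (f i) := by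
  classical
  induction s using Finset.induction_on with
  | empty => simp [expNeg_zero]
  | insert a s ha ih => rw [Finset.sum_insert ha, Finset.prod_insert ha, expNeg_add, ih]

lemma expNeg_mul_natCast (c : ℝ≥0∞) (n : ℕ) : expNeg (c * n) = expNeg c ^ n := by
  induction n with
  | zero => simp [expNeg_zero]
  | succ n ih => rw [Nat.cast_succ, mul_add, expNeg_add, ih, mul_one, pow_succ]

/-- Laplace transforms of countable sums of independent variables multiply. -/
lemma lintegral_expNeg_tsum {Ω S : Type*} [MeasurableSpace Ω] [Countable S] {μ : Measure Ω}
    {Z : S → Ω → ℝ≥0∞} (hZ : ∀ s, AEMeasurable (Z s) μ) (hind : iIndepFun Z μ) {l : S → ℝ≥0∞}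
    (hl : ∀ s, ∫⁻ ω, expNeg (Z s ω) ∂μ = expNeg (l s)) :
    ∫⁻ ω, expNeg (∑' s, Z s ω) ∂μ = expNeg (∑' s, l s) := by
  have := hind.isProbabilityMeasure
  have hae : ∀ᵐ ω ∂μ, ∀ s, Z s ω = (hZ s).mk (Z s) ω := ae_all_iff.2 fun s => (hZ s).ae_eq_mk
  -- The variables are only a.e. measurable; countability of `S` allows replacing all of them at
  -- once by measurable versions.
  set Y : S → Ω → ℝ≥0∞ := fun s => (hZ s).mk (Z s)
  have hYm : ∀ s, Measurable (Y s) := fun s => (hZ s).measurable_mk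
  have hYi : iIndepFun Y μ := (iIndepFun_congr fun s => (hZ s).ae_eq_mk).1 hind
  have hfin : ∀ F : Finset S, ∫⁻ ω, expNeg (∑ s ∈ F, Y s ω) ∂μ = expNeg (∑ s ∈ F, l s) := by
    intro F
    simp_rw [expNeg_sum]
    rw [lintegral_prod_eq_prod_lintegral_of_indepFun F (fun s ω => expNeg (Y s ω))
      (hYi.comp (fun _ => expNeg) fun _ => measurable_expNeg)
      fun s => measurable_expNeg.comp (hYm s)]
    refine Finset.prod_congr rfl fun s _ => ?_
    rw [← hl s]
    exact lintegral_congr_ae (hae.mono fun ω h => by simp only [h s, Y])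
  have h1 : ∫⁻ ω, expNeg (∑' s, Z s ω) ∂μ = ∫⁻ ω, expNeg (∑' s, Y s ω) ∂μ :=
    lintegral_congr_ae (hae.mono fun ω h => by simp only [h, Y])
  rw [h1]
  refine tendsto_nhds_unique (f := fun F : Finset S => ∫⁻ ω, expNeg (∑ s ∈ F, Y s ω) ∂μ)
    (l := Filter.atTop) ?_ ?_
  · refine tendsto_lintegral_filter_of_dominated_convergence (fun _ => 1)
      (.of_forall fun F => measurable_expNeg.comp (F.measurable_fun_sum fun s _ => hYm s))
      (.of_forall fun F => .of_forall fun ω => expNeg_le_one _) (by simp)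
      (.of_forall fun ω => ?_)
    exact (continuous_expNeg.tendsto _).comp ENNReal.summable.hasSum
  · simp_rw [hfin]
    exact (continuous_expNeg.tendsto _).comp ENNReal.summable.hasSum

/-! ### The Laplace functional of a Poisson process -/

/-- The probability generating function of the Poisson law, from the exponential series at `r p`. -/
lemma tsum_poisson_pow (r p : ℝ≥0) :
    ∑' n : ℕ, (p : ℝ≥0∞) ^ n * ENNReal.ofReal (Real.exp (-r) * r ^ n / n.factorial) =
      ENNReal.ofReal (Real.exp (-(r * (1 - p)))) := by
  have h : HasSum (fun n : ℕ => Real.exp (-r) * ((r * p : ℝ) ^ n / n.factorial))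
      (Real.exp (-r) * Real.exp (r * p)) := by
    refine HasSum.mul_left _ ?_
    rw [Real.exp_eq_exp_ℝ]
    exact NormedSpace.expSeries_div_hasSum_exp (r * p : ℝ)
  rw [← Real.exp_add] at h
  rw [show -((r : ℝ) * (1 - p)) = -r + r * p by ring, ← h.tsum_eq,
    ENNReal.ofReal_tsum_of_nonneg (fun n => by positivity) h.summable]
  refine tsum_congr fun n => ?_
  rw [← ENNReal.ofReal_coe_nnreal, ← ENNReal.ofReal_pow (by positivity),
    ← ENNReal.ofReal_mul (by positivity)]
  congr 1
  rw [mul_pow]; ring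

/-- The Laplace transform of a Poisson variable. -/
lemma lintegral_expNeg_poissonMeasure (r : ℝ≥0) (c : ℝ≥0∞) :
    ∫⁻ n : ℕ∞, expNeg (c * n) ∂((poissonMeasure r).map (fun n : ℕ => (n : ℕ∞))) =
      expNeg (r * (1 - expNeg c)) := by
  rw [lintegral_map measurable_from_top measurable_from_top, lintegral_countable']
  obtain ⟨p, hp⟩ : ∃ p : ℝ≥0, (p : ℝ≥0∞) = expNeg c :=
    ⟨_, ENNReal.coe_toNNReal (expNeg_ne_top c)⟩
  have hp1 : p ≤ 1 := by
    have := expNeg_le_one c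
    rw [← hp] at this; exact_mod_cast this
  simp_rw [poissonMeasure_singleton, ENat.toENNReal_coe, expNeg_mul_natCast, ← hp]
  rw [tsum_poisson_pow r p, ← expNeg_ofReal]
  · congr 1
    rw [ENNReal.ofReal_mul (by positivity), ENNReal.ofReal_coe_nnreal,
      ENNReal.ofReal_sub _ (by positivity), ENNReal.ofReal_one, ENNReal.ofReal_coe_nnreal]
  · have : (p : ℝ) ≤ 1 := by exact_mod_cast hp1
    have : (0 : ℝ) ≤ 1 - p := by linarith
    positivity

lemma tsum_indicator_const {Ω ι : Type} (X : ι → Ω → Plane) (A : Set Plane) (c : ℝ≥0∞) (ω : Ω) :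
    ∑' i, A.indicator (fun _ => c) (X i ω) = c * (pointCount X A ω : ℝ≥0∞) := by
  unfold pointCount
  rw [← ENNReal.tsum_set_one, ← ENNReal.tsum_mul_left, mul_one,
    tsum_subtype {i | X i ω ∈ A} (fun _ => c)]
  rfl

variable {Ω ι : Type} [MeasurableSpace Ω] {X : ι → Ω → Plane} {lam : ℝ≥0}
  {μ : Measure Ω}

/-- For simple `g` the sum over the points is `∑ c · N(g⁻¹{c})`, a combination of independent
Poisson counts over disjoint level sets. The value `0` must be left out: its level set has infinite
area, and it contributes nothing. -/
lemma IsPoissonProcess.lintegral_expNeg_simpleFunc (h : IsPoissonProcess X lam μ)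
    (g : SimpleFunc Plane ℝ≥0∞) (hg : ∀ c ≠ 0, volume (g ⁻¹' {c}) ≠ ∞) :
    ∫⁻ ω, expNeg (∑' i, g (X i ω)) ∂μ = expNeg (lam * ∫⁻ x, (1 - expNeg (g x))) := by
  classical
  set S : Finset ℝ≥0∞ := g.range.filter (· ≠ 0)
  have hsum : ∀ ω, ∑' i, g (X i ω) =
      ∑' c : S, (c : ℝ≥0∞) * (pointCount X (g ⁻¹' {(c : ℝ≥0∞)}) ω : ℝ≥0∞) := by
    intro ω
    simp_rw [← tsum_indicator_const]
    rw [ENNReal.tsum_comm]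
    refine tsum_congr fun i => ?_
    rw [tsum_fintype, Finset.sum_coe_sort S
      (fun c => (g ⁻¹' {c}).indicator (fun _ => c) (X i ω))]
    simp_rw [Set.indicator_apply, Set.mem_preimage, Set.mem_singleton_iff]
    rw [Finset.sum_ite_eq]
    split_ifs with hS
    · rfl
    · by_contra hne
      exact hS (Finset.mem_filter.2 ⟨g.mem_range_self _, hne⟩)
  have hvol : ∀ c : S, volume (g ⁻¹' {(c : ℝ≥0∞)}) ≠ ∞ := fun c =>
    hg c (Finset.mem_filter.1 c.2).2
  have hind0 : iIndepFun (fun c : S => pointCount X (g ⁻¹' {(c : ℝ≥0∞)})) μ := by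
    let e := Fintype.equivFin S
    have := h.count_indep (Fintype.card S) (fun j => g ⁻¹' {((e.symm j : S) : ℝ≥0∞)})
      (fun j => g.measurableSet_fiber _) (fun i j hij => by
        refine Set.disjoint_left.2 fun x hx hy => hij ?_
        simp only [Set.mem_preimage, Set.mem_singleton_iff] at hx hy
        exact e.symm.injective (Subtype.ext (hx.symm.trans hy)))
    have h2 := this.precomp e.injective
    simpa using h2
  have hmeas : ∀ c : S, AEMeasurable (pointCount X (g ⁻¹' {(c : ℝ≥0∞)})) μ := fun c =>
    (h.count_law _ (g.measurableSet_fiber _) (hvol c)).aemeasurable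
  simp_rw [hsum]
  rw [lintegral_expNeg_tsum (l := fun c : S =>
    (lam * (volume (g ⁻¹' {(c : ℝ≥0∞)})).toNNReal : ℝ≥0) * (1 - expNeg c))]
  · congr 1
    have hg1 : ∫⁻ x, (1 - expNeg (g x)) = (g.map (fun c => 1 - expNeg c)).lintegral volume := by
      rw [← SimpleFunc.lintegral_eq_lintegral]; rfl
    rw [hg1, SimpleFunc.map_lintegral, Finset.mul_sum, tsum_fintype,
      Finset.sum_coe_sort S (fun c =>
        ((lam * (volume (g ⁻¹' {c})).toNNReal : ℝ≥0) : ℝ≥0∞) * (1 - expNeg c)),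
      Finset.sum_filter]
    refine Finset.sum_congr rfl fun c _ => ?_
    split_ifs with hc
    · rw [ENNReal.coe_mul, ENNReal.coe_toNNReal (hg c hc)]; ring
    · rw [not_not.1 hc, expNeg_zero]; simp
  · exact fun c => (measurable_from_top (f := fun n : ℕ∞ => (c : ℝ≥0∞) * n)).comp_aemeasurable
      (hmeas c)
  · exact hind0.comp (fun c n => (c : ℝ≥0∞) * (n : ℕ∞)) fun _ => measurable_from_top
  · intro c
    rw [← lintegral_expNeg_poissonMeasure]
    exact (h.count_law _ (g.measurableSet_fiber _) (hvol c)).lintegral_comp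
      (f := fun n : ℕ∞ => expNeg (c * n)) measurable_from_top.aemeasurable

/-- The Laplace functional of a Poisson process. -/
lemma IsPoissonProcess.lintegral_expNeg [Countable ι] [IsProbabilityMeasure μ] (h : IsPoissonProcess X lam μ)
    {f : Plane → ℝ≥0∞} (hf : Measurable f) :
    ∫⁻ ω, expNeg (∑' i, f (X i ω)) ∂μ = expNeg (lam * ∫⁻ x, (1 - expNeg (f x))) := by
  -- Cutting off to the ball of radius `n` gives the nonzero level sets finite area, and the
  -- approximation stays monotone.
  set g : ℕ → SimpleFunc Plane ℝ≥0∞ := fun n =>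
    (SimpleFunc.eapprox f n).restrict (Metric.ball 0 n)
  have hgapp : ∀ n x, g n x = (Metric.ball (0 : Plane) n).indicator (SimpleFunc.eapprox f n) x :=
    fun n x => SimpleFunc.restrict_apply _ Metric.isOpen_ball.measurableSet x
  have hmono : ∀ x, Monotone fun n => g n x := by
    intro x m n hmn
    simp only [hgapp]
    refine (Set.indicator_le_indicator_of_subset
      (Metric.ball_subset_ball (Nat.cast_le.2 hmn)) (fun _ => zero_le) x).trans ?_
    exact Set.indicator_le_indicator (SimpleFunc.monotone_eapprox f hmn x)
  have htend : ∀ x, Filter.Tendsto (fun n => g n x) Filter.atTop (nhds (f x)) := by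
    intro x
    have h1 : Filter.Tendsto (fun n => SimpleFunc.eapprox f n x) Filter.atTop (nhds (f x)) := by
      rw [← SimpleFunc.iSup_eapprox_apply hf x]
      exact tendsto_atTop_iSup fun m n hmn => SimpleFunc.monotone_eapprox f hmn x
    refine h1.congr' ?_
    obtain ⟨N, hN⟩ := exists_nat_gt ‖x‖
    filter_upwards [Filter.eventually_ge_atTop N] with n hn
    have : (N : ℝ) ≤ n := by exact_mod_cast hn
    rw [hgapp, Set.indicator_of_mem]
    simp only [Metric.mem_ball, dist_zero_right]
    linarith
  have hvol : ∀ n, ∀ c ≠ 0, volume (g n ⁻¹' {c}) ≠ ∞ := by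
    intro n c hc
    refine ((measure_mono ?_).trans_lt (measure_ball_lt_top (x := (0 : Plane)) (r := n))).ne
    intro x hx
    by_contra hnot
    simp only [Set.mem_preimage, hgapp, Set.indicator_of_notMem hnot, Set.mem_singleton_iff] at hx
    exact hc hx.symm
  have hsumtend : ∀ ω, Filter.Tendsto (fun n => ∑' i, g n (X i ω)) Filter.atTop
      (nhds (∑' i, f (X i ω))) := by
    intro ω
    -- The sum over the points is an integral for the counting measure, so monotone convergence
    -- applies.
    let _ : MeasurableSpace ι := ⊤
    simp_rw [← lintegral_count]
    exact lintegral_tendsto_of_tendsto_of_monotone (fun n => measurable_from_top.aemeasurable)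
      (.of_forall fun i => hmono _) (.of_forall fun i => htend _)
  refine tendsto_nhds_unique (f := fun n => ∫⁻ ω, expNeg (∑' i, g n (X i ω)) ∂μ)
    (l := Filter.atTop) ?_ ?_
  · refine tendsto_lintegral_of_dominated_convergence (fun _ => 1)
      (fun n => measurable_expNeg.comp
        (Measurable.tsum fun i => (g n).measurable.comp (h.measurable i)))
      (fun n => .of_forall fun ω => expNeg_le_one _) (by simp)
      (.of_forall fun ω => (continuous_expNeg.tendsto _).comp (hsumtend ω))
  · simp_rw [fun n => h.lintegral_expNeg_simpleFunc (g n) (hvol n)]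
    refine (continuous_expNeg.tendsto _).comp
      (ENNReal.Tendsto.const_mul ?_ (Or.inr ENNReal.coe_ne_top))
    -- `1 - e^{-g_n}` increases with `n`, so this limit holds even if the integral is infinite.
    refine lintegral_tendsto_of_tendsto_of_monotone
      (fun n => (measurable_const.sub (measurable_expNeg.comp (g n).measurable)).aemeasurable)
      (.of_forall fun x m n hmn => tsub_le_tsub_left (expNeg_antitone (hmono x hmn)) _)
      (.of_forall fun x => ?_)
    exact ENNReal.Tendsto.sub tendsto_const_nhds ((continuous_expNeg.tendsto _).comp (htend x))
      (Or.inl ENNReal.one_ne_top)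

end

noncomputable section

/-! ### The complex Gaussian law -/

lemma measurable_ofReal_add_mul_I :
    Measurable (fun p : ℝ × ℝ => (p.1 : ℂ) + (p.2 : ℂ) * Complex.I) := by
  fun_prop

instance : IsProbabilityMeasure stdComplexGaussian :=
  Measure.isProbabilityMeasure_map measurable_ofReal_add_mul_I.aemeasurable

instance (n : ℕ) : IsProbabilityMeasure (rayleighVector n) := by
  unfold rayleighVector; infer_instance

lemma stdComplexGaussian_eq_withDensity :
    stdComplexGaussian =
      (volume : Measure ℂ).withDensity (fun z => ENNReal.ofReal (Real.exp (-‖z‖ ^ 2) / Real.pi)) := by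
  have hv : (1 / 2 : ℝ≥0) ≠ 0 := by norm_num
  have hmap : (fun p : ℝ × ℝ => (p.1 : ℂ) + (p.2 : ℂ) * Complex.I) =
      Complex.measurableEquivRealProd.symm := by
    ext p; simp [Complex.measurableEquivRealProd_symm_apply, Complex.mk_eq_add_mul_I]
  have hdens : ∀ p : ℝ × ℝ, gaussianPDF 0 (1 / 2) p.1 * gaussianPDF 0 (1 / 2) p.2 =
      ENNReal.ofReal (Real.exp (-‖Complex.measurableEquivRealProd.symm p‖ ^ 2) / Real.pi) := by
    intro p
    rw [gaussianPDF, gaussianPDF, ← ENNReal.ofReal_mul (gaussianPDFReal_nonneg _ _ _)]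
    congr 1
    have h1 : ‖Complex.measurableEquivRealProd.symm p‖ ^ 2 = p.1 ^ 2 + p.2 ^ 2 := by
      rw [Complex.measurableEquivRealProd_symm_apply, ← Complex.normSq_eq_norm_sq,
        Complex.normSq_mk]; ring
    have h2 : (√Real.pi)⁻¹ * (√Real.pi)⁻¹ = Real.pi⁻¹ := by
      rw [← mul_inv, Real.mul_self_sqrt Real.pi_pos.le]
    rw [h1]
    simp only [gaussianPDFReal]
    push_cast
    rw [show (2 : ℝ) * Real.pi * (1 / 2) = Real.pi by ring,
      show -(p.1 ^ 2 + p.2 ^ 2) = -(p.1 - 0) ^ 2 / (2 * (1 / 2)) + -(p.2 - 0) ^ 2 / (2 * (1 / 2)) by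
        ring, Real.exp_add, div_eq_mul_inv _ Real.pi, ← h2]
    ring
  unfold stdComplexGaussian
  rw [hmap, gaussianReal_of_var_ne_zero _ hv, prod_withDensity (measurable_gaussianPDF _ _)
    (measurable_gaussianPDF _ _)]
  simp_rw [hdens]
  ext s hs
  rw [Measure.map_apply Complex.measurableEquivRealProd.symm.measurable hs,
    withDensity_apply _ (Complex.measurableEquivRealProd.symm.measurable hs),
    withDensity_apply _ hs]
  exact Complex.volume_preserving_equiv_real_prod.symm.setLIntegral_comp_preimage hs
    (f := fun z => ENNReal.ofReal (Real.exp (-‖z‖ ^ 2) / Real.pi)) (by fun_prop)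

lemma lintegral_stdComplexGaussian {F : ℂ → ℝ≥0∞} (hF : Measurable F) :
    ∫⁻ z, F z ∂stdComplexGaussian =
      ∫⁻ z, ENNReal.ofReal (Real.exp (-‖z‖ ^ 2) / Real.pi) * F z := by
  rw [stdComplexGaussian_eq_withDensity]
  exact lintegral_withDensity_eq_lintegral_mul _ (by fun_prop) hF

instance : NullSingletonClass stdComplexGaussian := by
  rw [stdComplexGaussian_eq_withDensity]; infer_instance

/-- Exponential tilting by the squared norm rescales the Gaussian law. -/
lemma stdComplexGaussian_withDensity {t : ℝ} (ht : 0 ≤ t) :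
    stdComplexGaussian.withDensity (fun z => ENNReal.ofReal (Real.exp (-(t * ‖z‖ ^ 2)))) =
      ENNReal.ofReal (1 + t)⁻¹ •
        stdComplexGaussian.map (fun z => ((√(1 + t))⁻¹ : ℝ) • z) := by
  have h1 : 0 < 1 + t := by linarith
  have hs : 0 < √(1 + t) := Real.sqrt_pos.2 h1
  ext A hA
  have hm : Measurable fun z : ℂ => ((√(1 + t))⁻¹ : ℝ) • z := by fun_prop
  have hAm : Measurable (A.indicator (1 : ℂ → ℝ≥0∞)) := measurable_one.indicator hA
  rw [withDensity_apply _ hA, ← lintegral_indicator hA, lintegral_stdComplexGaussian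
    ((by fun_prop : Measurable _).indicator hA), Measure.smul_apply, ← lintegral_indicator_one hA,
    lintegral_map hAm hm,
    lintegral_stdComplexGaussian (F := fun z => A.indicator 1 (((√(1 + t))⁻¹ : ℝ) • z)) (hAm.comp hm),
    smul_eq_mul]
  set G : ℂ → ℝ≥0∞ := fun z =>
    ENNReal.ofReal (Real.exp (-((1 + t) * ‖z‖ ^ 2)) / Real.pi) * A.indicator 1 z with hG
  have hGm : Measurable G := by fun_prop
  have hL : ∀ z, ENNReal.ofReal (Real.exp (-‖z‖ ^ 2) / Real.pi) *
      A.indicator (fun z => ENNReal.ofReal (Real.exp (-(t * ‖z‖ ^ 2)))) z = G z := by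
    intro z
    by_cases hz : z ∈ A
    · simp only [hG, Set.indicator_of_mem hz, Pi.one_apply, mul_one]
      rw [← ENNReal.ofReal_mul (by positivity)]
      congr 1
      rw [div_mul_eq_mul_div, ← Real.exp_add]
      congr 2; ring
    · simp [hG, Set.indicator_of_notMem hz]
  have hR : ∀ z, ENNReal.ofReal (Real.exp (-‖z‖ ^ 2) / Real.pi) *
      A.indicator 1 (((√(1 + t))⁻¹ : ℝ) • z) = G (((√(1 + t))⁻¹ : ℝ) • z) := by
    intro z
    simp only [hG]
    congr 4
    rw [norm_smul, Real.norm_eq_abs, mul_pow, sq_abs, inv_pow, Real.sq_sqrt h1.le,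
      mul_inv_cancel_left₀ h1.ne']
  simp_rw [hL, hR]
  -- In real dimension two the dilation by `(1 + t)^{-1/2}` has inverse Jacobian `1 + t`, which
  -- cancels the prefactor.
  rw [← lintegral_map hGm hm, Measure.map_addHaar_smul _ (inv_ne_zero hs.ne'),
    lintegral_smul_measure, smul_eq_mul, ← mul_assoc, ← ENNReal.ofReal_mul (by positivity)]
  rw [Complex.finrank_real_complex, inv_pow, inv_inv, Real.sq_sqrt h1.le, abs_of_pos h1,
    inv_mul_cancel₀ h1.ne', ENNReal.ofReal_one, one_mul]

/-- The Laplace transform of the squared modulus of a complex Gaussian. -/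
lemma lintegral_exp_neg_norm_sq_stdComplexGaussian {t : ℝ} (ht : 0 ≤ t) :
    ∫⁻ z, ENNReal.ofReal (Real.exp (-(t * ‖z‖ ^ 2))) ∂stdComplexGaussian =
      ENNReal.ofReal (1 + t)⁻¹ := by
  have := congrArg (fun μ : Measure ℂ => μ Set.univ) (stdComplexGaussian_withDensity ht)
  have hm : Measurable fun z : ℂ => ((√(1 + t))⁻¹ : ℝ) • z := by fun_prop
  have h1 := Measure.isProbabilityMeasure_map (μ := stdComplexGaussian) hm.aemeasurable
  simpa only [withDensity_apply _ MeasurableSet.univ, Measure.restrict_univ, Measure.smul_apply,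
    measure_univ, smul_eq_mul, mul_one] using this

lemma lintegral_mul_exp_neg_sq_Ioi {a : ℝ} (ha : 0 ≤ a) :
    ∫⁻ x in Set.Ioi a, ENNReal.ofReal (2 * x * Real.exp (-x ^ 2)) =
      ENNReal.ofReal (Real.exp (-a ^ 2)) := by
  have hd : ∀ x : ℝ, HasDerivAt (fun x => -Real.exp (-x ^ 2)) (2 * x * Real.exp (-x ^ 2)) x := by
    intro x
    have := ((hasDerivAt_pow 2 x).neg.exp).neg
    convert! this using 1
    simp; ring
  have hpos : ∀ x ∈ Set.Ioi a, 0 ≤ 2 * x * Real.exp (-x ^ 2) := fun x hx => by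
    have : 0 < x := ha.trans_lt hx
    positivity
  have hlim : Filter.Tendsto (fun x : ℝ => -Real.exp (-x ^ 2)) Filter.atTop (nhds 0) := by
    rw [← neg_zero]
    refine (Real.tendsto_exp_neg_atTop_nhds_zero.comp
      (Filter.tendsto_pow_atTop (two_ne_zero))).neg
  rw [← ofReal_integral_eq_lintegral_ofReal, integral_Ioi_of_hasDerivAt_of_nonneg'
    (fun x _ => hd x) hpos hlim]
  · simp
  · exact integrableOn_Ioi_deriv_of_nonneg' (fun x _ => hd x) hpos hlim
  · exact (ae_restrict_iff' measurableSet_Ioi).2 (.of_forall hpos)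

/-- The squared modulus of a complex Gaussian is exponential. -/
lemma stdComplexGaussian_norm_sq_gt {t : ℝ} (ht : 0 ≤ t) :
    stdComplexGaussian {z | t < ‖z‖ ^ 2} = ENNReal.ofReal (Real.exp (-t)) := by
  have hS : MeasurableSet {z : ℂ | t < ‖z‖ ^ 2} := measurableSet_lt (by fun_prop) (by fun_prop)
  rw [← lintegral_indicator_one hS, lintegral_stdComplexGaussian (measurable_one.indicator hS),
    ← Complex.lintegral_comp_polarCoord_symm, polarCoord_target, Measure.volume_eq_prod,
    ← Measure.prod_restrict, lintegral_prod _ (by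
      refine Measurable.aemeasurable ?_
      have h1 : Measurable fun p : ℝ × ℝ => Complex.polarCoord.symm p := by
        simp_rw [Complex.polarCoord_symm_apply]; fun_prop
      have h2 : Measurable ({z : ℂ | t < ‖z‖ ^ 2}.indicator (1 : ℂ → ℝ≥0∞)) :=
        measurable_one.indicator hS
      simp only [smul_eq_mul]
      fun_prop)]
  -- The angular integral contributes `2π` against the `1/π` of the density.
  have hpt : ∀ x ∈ Set.Ioi (0 : ℝ), (∫⁻ y in Set.Ioo (-Real.pi) Real.pi, ENNReal.ofReal (x, y).1 •
      (ENNReal.ofReal (Real.exp (-‖Complex.polarCoord.symm (x, y)‖ ^ 2) / Real.pi) *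
        {z : ℂ | t < ‖z‖ ^ 2}.indicator 1 (Complex.polarCoord.symm (x, y)))) =
      (Set.Ioi (√t)).indicator (fun x => ENNReal.ofReal (2 * x * Real.exp (-x ^ 2))) x := by
    intro x hx
    have hx' : (0 : ℝ) < x := hx
    have hind : ∀ y, ({z : ℂ | t < ‖z‖ ^ 2}.indicator 1 (Complex.polarCoord.symm (x, y)) : ℝ≥0∞) =
        (Set.Ioi (√t)).indicator 1 x := by
      intro y
      simp only [Set.indicator_apply, Set.mem_ofPred_eq, Complex.norm_polarCoord_symm, sq_abs,
        Set.mem_Ioi, Real.sqrt_lt' hx', Pi.one_apply]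
    simp_rw [hind, Complex.norm_polarCoord_symm, sq_abs]
    rw [setLIntegral_const, Real.volume_Ioo]
    by_cases hxt : x ∈ Set.Ioi (√t)
    · simp only [Set.indicator_of_mem hxt, Pi.one_apply, mul_one, smul_eq_mul]
      rw [← ENNReal.ofReal_mul hx'.le, ← ENNReal.ofReal_mul (by positivity)]
      congr 1
      field_simp
      ring
    · simp [Set.indicator_of_notMem hxt]
  rw [setLIntegral_congr_fun measurableSet_Ioi hpt, setLIntegral_indicator measurableSet_Ioi,
    Set.inter_eq_left.2 (Set.Ioi_subset_Ioi (Real.sqrt_nonneg t)),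
    lintegral_mul_exp_neg_sq_Ioi (Real.sqrt_nonneg t), Real.sq_sqrt ht]

lemma charFun_stdComplexGaussian (ξ : ℂ) :
    charFun stdComplexGaussian ξ = Complex.exp (-(‖ξ‖ ^ 2 / 4 : ℝ)) := by
  unfold stdComplexGaussian
  rw [charFun_apply, integral_map measurable_ofReal_add_mul_I.aemeasurable
    (by fun_prop)]
  have h : ∀ p : ℝ × ℝ, Complex.exp ((inner ℝ ((p.1 : ℂ) + (p.2 : ℂ) * Complex.I) ξ : ℝ) *
      Complex.I) = Complex.exp ((ξ.re : ℂ) * p.1 * Complex.I) *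
        Complex.exp ((ξ.im : ℂ) * p.2 * Complex.I) := by
    intro p
    rw [← Complex.exp_add]
    congr 1
    rw [Complex.inner]
    simp
    ring
  simp_rw [h]
  rw [integral_prod_mul (fun x : ℝ => Complex.exp ((ξ.re : ℂ) * x * Complex.I))
    (fun x : ℝ => Complex.exp ((ξ.im : ℂ) * x * Complex.I)), ← charFun_apply_real,
    ← charFun_apply_real, charFun_gaussianReal, charFun_gaussianReal, ← Complex.exp_add]
  congr 1
  rw [← Complex.normSq_eq_norm_sq, Complex.normSq_apply]
  push_cast
  ring

/-- The scalar product of a Rayleigh vector with a fixed unit vector is complex Gaussian. -/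
lemma rayleighVector_map_sum_mul {n : ℕ} {w : Fin n → ℂ} (hw : sqNorm w = 1) :
    (rayleighVector n).map (fun h => ∑ m, h m * w m) = stdComplexGaussian := by
  have hcomp : (fun h : Fin n → ℂ => ∑ m, h m * w m) =
      (fun p : Fin n → ℂ => ∑ m, p m) ∘ fun h m => h m * w m := rfl
  have hprob : ∀ m, IsProbabilityMeasure (stdComplexGaussian.map (fun z => z * w m)) := fun m =>
    Measure.isProbabilityMeasure_map (by fun_prop)
  have : IsProbabilityMeasure ((rayleighVector n).map (fun h => ∑ m, h m * w m)) :=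
    Measure.isProbabilityMeasure_map (Measurable.aemeasurable (by fun_prop))
  refine Measure.ext_of_charFun (funext fun ξ => ?_)
  rw [hcomp, ← Measure.map_map (by fun_prop) (by fun_prop), rayleighVector,
    Measure.pi_map_pi (f := fun m z => z * w m) (fun m => by fun_prop),
    charFun_map_sum_pi_eq_prod, Finset.prod_apply]
  have h1 : ∀ m, charFun (stdComplexGaussian.map (fun z => z * w m)) ξ =
      Complex.exp (-(‖ξ‖ ^ 2 * ‖w m‖ ^ 2 / 4 : ℝ)) := by
    intro m
    -- Multiplication by `w m` has real adjoint multiplication by its conjugate, so it moves onto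
    -- `ξ`.
    have : charFun (stdComplexGaussian.map (fun z => z * w m)) ξ =
        charFun stdComplexGaussian (ξ * starRingEnd ℂ (w m)) := by
      rw [charFun_apply, charFun_apply, integral_map (by fun_prop) (by fun_prop)]
      congr 1 with z
      congr 3
      rw [Complex.inner, Complex.inner, map_mul]
      congr 1; ring
    rw [this, charFun_stdComplexGaussian, norm_mul, RCLike.norm_conj, mul_pow]
  simp_rw [h1]
  rw [← Complex.exp_sum, charFun_stdComplexGaussian]
  congr 1
  rw [Finset.sum_neg_distrib, ← Complex.ofReal_sum, ← Finset.sum_div, ← Finset.mul_sum]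
  rw [show ∑ m, ‖w m‖ ^ 2 = 1 from hw, mul_one]

end

noncomputable section

/-! ### Isotropic vectors and the unmatched gain -/

lemma sqNorm_nonneg {n : ℕ} (g : Fin n → ℂ) : 0 ≤ sqNorm g :=
  Finset.sum_nonneg fun _ _ => sq_nonneg _

lemma beamGain_nonneg {n : ℕ} (g w : Fin n → ℂ) : 0 ≤ beamGain g w := sq_nonneg _

@[fun_prop]
lemma measurable_sqNorm {n : ℕ} : Measurable (sqNorm (n := n)) := by
  unfold sqNorm; fun_prop

@[fun_prop]
lemma measurable_beamGain {n : ℕ} :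
    Measurable (fun p : (Fin n → ℂ) × (Fin n → ℂ) => beamGain p.1 p.2) := by
  unfold beamGain; fun_prop

@[fun_prop]
lemma measurable_beamGain_left {n : ℕ} (w : Fin n → ℂ) : Measurable (fun v => beamGain v w) := by
  unfold beamGain; fun_prop

lemma sqNorm_smul {n : ℕ} (r : ℝ) (g : Fin n → ℂ) : sqNorm (r • g) = r ^ 2 * sqNorm g := by
  unfold sqNorm
  rw [Finset.mul_sum]
  refine Finset.sum_congr rfl fun m _ => ?_
  rw [Pi.smul_apply, norm_smul, mul_pow, Real.norm_eq_abs, sq_abs]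

lemma beamGain_smul {n : ℕ} (r : ℝ) (g w : Fin n → ℂ) :
    beamGain (r • g) w = r ^ 2 * beamGain g w := by
  unfold beamGain
  have : ∑ m, (r • g) m * w m = r • ∑ m, g m * w m := by
    rw [Finset.smul_sum]
    exact Finset.sum_congr rfl fun m _ => by rw [Pi.smul_apply, smul_mul_assoc]
  rw [this, norm_smul, mul_pow, Real.norm_eq_abs, sq_abs]

lemma sqNorm_eq_zero {n : ℕ} {g : Fin n → ℂ} : sqNorm g = 0 ↔ g = 0 := by
  unfold sqNorm
  rw [Finset.sum_eq_zero_iff_of_nonneg fun _ _ => sq_nonneg _]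
  simp [funext_iff]

/-- The direction of a vector. -/
def direction {n : ℕ} (g : Fin n → ℂ) : Fin n → ℂ := fun m => g m / (√(sqNorm g) : ℂ)

@[fun_prop]
lemma measurable_direction {n : ℕ} : Measurable (direction (n := n)) := by
  unfold direction; fun_prop

lemma direction_eq_smul {n : ℕ} (g : Fin n → ℂ) : direction g = (√(sqNorm g))⁻¹ • g := by
  ext m
  simp [direction, div_eq_inv_mul]

lemma isotropicUnitVector_eq_map (n : ℕ) :
    isotropicUnitVector n = (rayleighVector n).map direction := rfl

instance (n : ℕ) : IsProbabilityMeasure (isotropicUnitVector n) := by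
  rw [isotropicUnitVector_eq_map]
  exact Measure.isProbabilityMeasure_map measurable_direction.aemeasurable

instance (n : ℕ) : SFinite (rayleighVector n) := instSFiniteOfSigmaFinite

instance (n : ℕ) : SFinite (isotropicUnitVector n) := instSFiniteOfSigmaFinite

instance (m n : ℕ) : SFinite ((isotropicUnitVector m).prod (isotropicUnitVector n)) :=
  Measure.prod.instSFinite

lemma sqNorm_direction {n : ℕ} {g : Fin n → ℂ} (hg : g ≠ 0) : sqNorm (direction g) = 1 := by
  have h : sqNorm g ≠ 0 := fun h => hg (sqNorm_eq_zero.1 h)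
  rw [direction_eq_smul, sqNorm_smul, inv_pow, Real.sq_sqrt (sqNorm_nonneg g), inv_mul_cancel₀ h]

/-- Restores the norm to a direction; at `g = 0` both sides vanish, so no exception is needed. -/
lemma beamGain_direction_mul_sqNorm {n : ℕ} (g w : Fin n → ℂ) :
    beamGain (direction g) w * sqNorm g = beamGain g w := by
  by_cases hg : g = 0
  · subst hg; simp [beamGain, sqNorm]
  · have h : sqNorm g ≠ 0 := fun h => hg (sqNorm_eq_zero.1 h)
    rw [direction_eq_smul, beamGain_smul, inv_pow, Real.sq_sqrt (sqNorm_nonneg g)]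
    field_simp

lemma direction_smul {n : ℕ} {r : ℝ} (hr : 0 < r) (g : Fin n → ℂ) :
    direction (r • g) = direction g := by
  rw [direction_eq_smul, direction_eq_smul, sqNorm_smul, Real.sqrt_mul (sq_nonneg r),
    Real.sqrt_sq hr.le, smul_smul]
  congr 1
  field_simp

lemma ae_ne_zero_rayleighVector {n : ℕ} (hn : 1 ≤ n) : ∀ᵐ g ∂rayleighVector n, g ≠ 0 := by
  have : Nonempty (Fin n) := ⟨⟨0, hn⟩⟩
  have : NullSingletonClass (rayleighVector n) := by unfold rayleighVector; infer_instance
  exact Measure.ae_ne _ 0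

lemma ae_sqNorm_isotropicUnitVector {n : ℕ} (hn : 1 ≤ n) :
    ∀ᵐ w ∂isotropicUnitVector n, sqNorm w = 1 := by
  rw [isotropicUnitVector_eq_map, ae_map_iff measurable_direction.aemeasurable
    (measurableSet_eq_fun measurable_sqNorm measurable_const)]
  exact (ae_ne_zero_rayleighVector hn).mono fun g hg => sqNorm_direction hg

lemma rayleighVector_map_beamGain {n : ℕ} {w : Fin n → ℂ} (hw : sqNorm w = 1) :
    (rayleighVector n).map (fun h => beamGain h w) =
      stdComplexGaussian.map (fun z => ‖z‖ ^ 2) := by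
  rw [← rayleighVector_map_sum_mul hw, Measure.map_map (by fun_prop) (by fun_prop)]
  rfl

/-- The gain of an unmatched beam is distributed as the squared modulus of a complex Gaussian. -/
lemma unmatchedGainLaw_eq {M : ℕ} (hM : 1 ≤ M) :
    unmatchedGainLaw M = stdComplexGaussian.map (fun z => ‖z‖ ^ 2) := by
  ext A hA
  have hpre : MeasurableSet ((fun p : (Fin M → ℂ) × (Fin M → ℂ) => beamGain p.1 p.2) ⁻¹' A) :=
    measurable_beamGain hA
  rw [unmatchedGainLaw, Measure.map_apply measurable_beamGain hA, Measure.prod_apply_symm hpre]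
  -- Given the beam, the law of the gain is the same for every unit vector `w`.
  have : ∀ᵐ w ∂isotropicUnitVector M, rayleighVector M ((fun h => (h, w)) ⁻¹'
      ((fun p : (Fin M → ℂ) × (Fin M → ℂ) => beamGain p.1 p.2) ⁻¹' A)) =
      (stdComplexGaussian.map (fun z => ‖z‖ ^ 2)) A := by
    filter_upwards [ae_sqNorm_isotropicUnitVector hM] with w hw
    rw [← rayleighVector_map_beamGain hw, Measure.map_apply (measurable_beamGain_left w) hA]
    rfl
  rw [lintegral_congr_ae this]
  simp

lemma unmatchedGainLaw_Ioi {M : ℕ} (hM : 1 ≤ M) {t : ℝ} (ht : 0 ≤ t) :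
    unmatchedGainLaw M (Set.Ioi t) = ENNReal.ofReal (Real.exp (-t)) := by
  rw [unmatchedGainLaw_eq hM, Measure.map_apply (by fun_prop) measurableSet_Ioi,
    ← stdComplexGaussian_norm_sq_gt ht]
  rfl

lemma lintegral_exp_neg_unmatchedGainLaw {M : ℕ} (hM : 1 ≤ M) {t : ℝ} (ht : 0 ≤ t) :
    ∫⁻ x, ENNReal.ofReal (Real.exp (-(t * x))) ∂unmatchedGainLaw M =
      ENNReal.ofReal (1 + t)⁻¹ := by
  rw [unmatchedGainLaw_eq hM, lintegral_map (by fun_prop) (by fun_prop),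
    lintegral_exp_neg_norm_sq_stdComplexGaussian ht]

lemma ae_nonneg_unmatchedGainLaw (M : ℕ) : ∀ᵐ x ∂unmatchedGainLaw M, 0 ≤ x := by
  rw [unmatchedGainLaw, ae_map_iff measurable_beamGain.aemeasurable measurableSet_Ici]
  exact .of_forall fun p => beamGain_nonneg _ _

/-! ### Norm and direction of a Rayleigh vector -/

/-- Densities of product form commute with finite products of probability measures. -/
lemma pi_withDensity_prod {ι : Type*} [Fintype ι] {E : ι → Type*} [∀ i, MeasurableSpace (E i)]
    (μ : ∀ i, Measure (E i)) [∀ i, IsProbabilityMeasure (μ i)] {f : ∀ i, E i → ℝ≥0∞}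
    (hf : ∀ i, Measurable (f i)) [∀ i, SigmaFinite ((μ i).withDensity (f i))] :
    (Measure.pi μ).withDensity (fun x => ∏ i, f i (x i)) =
      Measure.pi (fun i => (μ i).withDensity (f i)) := by
  refine (Measure.pi_eq fun s hs => ?_).symm
  rw [withDensity_apply _ (.univ_pi hs), ← lintegral_indicator (.univ_pi hs)]
  have h1 : ∀ x, (Set.univ.pi s).indicator (fun x => ∏ i, f i (x i)) x =
      ∏ i, (s i).indicator (f i) (x i) := by
    intro x
    by_cases hx : x ∈ Set.univ.pi s
    · rw [Set.indicator_of_mem hx]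
      exact Finset.prod_congr rfl fun i _ => (Set.indicator_of_mem (hx i trivial) _).symm
    · rw [Set.indicator_of_notMem hx]
      obtain ⟨i, hi⟩ : ∃ i, x i ∉ s i := by simpa [Set.mem_pi] using hx
      exact (Finset.prod_eq_zero (Finset.mem_univ i) (Set.indicator_of_notMem hi _)).symm
  simp_rw [h1]
  have hm : ∀ i, Measurable ((s i).indicator (f i)) := fun i => (hf i).indicator (hs i)
  rw [lintegral_prod_eq_prod_lintegral_of_indepFun Finset.univ
    (fun i (x : ∀ i, E i) => (s i).indicator (f i) (x i)) (iIndepFun_pi fun i => (hm i).aemeasurable)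
    fun i => (hm i).comp (measurable_pi_apply i)]
  refine Finset.prod_congr rfl fun i _ => ?_
  rw [withDensity_apply _ (hs i), ← lintegral_indicator (hs i)]
  exact (measurePreserving_eval μ i).lintegral_comp (hm i)

/-- Exponential tilting by the squared norm rescales the Rayleigh law. -/
lemma rayleighVector_withDensity (n : ℕ) {t : ℝ} (ht : 0 ≤ t) :
    (rayleighVector n).withDensity (fun g => ENNReal.ofReal (Real.exp (-(t * sqNorm g)))) =
      ENNReal.ofReal ((1 + t)⁻¹ ^ n) •
        (rayleighVector n).map (fun g => ((√(1 + t))⁻¹ : ℝ) • g) := by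
  have hprob : IsProbabilityMeasure (stdComplexGaussian.map (fun z => ((√(1 + t))⁻¹ : ℝ) • z)) :=
    Measure.isProbabilityMeasure_map (by fun_prop)
  have hfin : IsFiniteMeasure (stdComplexGaussian.withDensity
      (fun z => ENNReal.ofReal (Real.exp (-(t * ‖z‖ ^ 2))))) := by
    rw [stdComplexGaussian_withDensity ht]
    exact Measure.smul_finite _ ENNReal.ofReal_ne_top
  have h1 : (fun g : Fin n → ℂ => ENNReal.ofReal (Real.exp (-(t * sqNorm g)))) =
      fun g => ∏ m, ENNReal.ofReal (Real.exp (-(t * ‖g m‖ ^ 2))) := by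
    ext g
    rw [← ENNReal.ofReal_prod_of_nonneg fun _ _ => (Real.exp_pos _).le, ← Real.exp_sum,
      Finset.sum_neg_distrib, ← Finset.mul_sum]
    rfl
  rw [h1, rayleighVector, pi_withDensity_prod (fun _ : Fin n => stdComplexGaussian)
    (f := fun _ z => ENNReal.ofReal (Real.exp (-(t * ‖z‖ ^ 2)))) (fun _ => by fun_prop)]
  refine Measure.pi_eq fun s hs => ?_
  have h2 : Measure.map (fun g : Fin n → ℂ => ((√(1 + t))⁻¹ : ℝ) • g)
      (Measure.pi fun _ => stdComplexGaussian) =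
      Measure.pi fun _ => stdComplexGaussian.map (fun z => ((√(1 + t))⁻¹ : ℝ) • z) :=
    Measure.pi_map_pi (f := fun _ z => ((√(1 + t))⁻¹ : ℝ) • z) (fun m => by fun_prop)
  rw [h2, Measure.smul_apply, Measure.pi_pi, stdComplexGaussian_withDensity ht]
  simp_rw [Measure.smul_apply, smul_eq_mul]
  rw [Finset.prod_mul_distrib, Finset.prod_const, Finset.card_univ, Fintype.card_fin,
    ENNReal.ofReal_pow (by positivity)]

/-- Tilting by `e^{-t‖g‖²}` amounts to a dilation, which `F` does not see. This is independence of
norm and direction, for a constant rate `t`. -/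
lemma lintegral_exp_neg_sqNorm_mul {n : ℕ} {t : ℝ} (ht : 0 ≤ t) {F : (Fin n → ℂ) → ℝ≥0∞}
    (hF : Measurable F) (hhom : ∀ (r : ℝ) g, 0 < r → F (r • g) = F g) :
    ∫⁻ g, ENNReal.ofReal (Real.exp (-(t * sqNorm g))) * F g ∂rayleighVector n =
      ENNReal.ofReal ((1 + t)⁻¹ ^ n) * ∫⁻ g, F g ∂rayleighVector n := by
  have hw := lintegral_withDensity_eq_lintegral_mul (rayleighVector n)
    (f := fun g => ENNReal.ofReal (Real.exp (-(t * sqNorm g)))) (by fun_prop) hF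
  have hs : 0 < (√(1 + t))⁻¹ := inv_pos.2 (Real.sqrt_pos.2 (by linarith))
  rw [rayleighVector_withDensity n ht, lintegral_smul_measure, lintegral_map hF (by fun_prop)] at hw
  simp_rw [hhom _ _ hs] at hw
  exact hw.symm

lemma lintegral_exp_neg_sqNorm (n : ℕ) {t : ℝ} (ht : 0 ≤ t) :
    ∫⁻ g, ENNReal.ofReal (Real.exp (-(t * sqNorm g))) ∂rayleighVector n =
      ENNReal.ofReal ((1 + t)⁻¹ ^ n) := by
  simpa using lintegral_exp_neg_sqNorm_mul (n := n) ht (F := fun _ => 1) measurable_const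
    fun _ _ _ => rfl

/-- On each of the countably many level sets of `b` the rate is constant, and the indicator of a
level set is itself invariant under dilations. -/
lemma lintegral_exp_neg_mul_sqNorm_of_countable {n : ℕ} {c : ℝ} (hc : 0 ≤ c)
    {b : (Fin n → ℂ) → ℕ} (hb : Measurable b) (hhom : ∀ (r : ℝ) g, 0 < r → b (r • g) = b g) :
    ∫⁻ g, ENNReal.ofReal (Real.exp (-(c * b g * sqNorm g))) ∂rayleighVector n =
      ∫⁻ g, ENNReal.ofReal ((1 + c * b g)⁻¹ ^ n) ∂rayleighVector n := by
  have hsplit : ∀ F : (Fin n → ℂ) → ℝ≥0∞, Measurable F → ∫⁻ g, F g ∂rayleighVector n =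
      ∑' k : ℕ, ∫⁻ g, F g * (b ⁻¹' {k}).indicator 1 g ∂rayleighVector n := by
    intro F hF
    have hsum := lintegral_tsum (μ := rayleighVector n)
      (f := fun (k : ℕ) g => F g * (b ⁻¹' {k}).indicator 1 g) fun k => (hF.mul
        (measurable_one.indicator (hb (measurableSet_singleton k)))).aemeasurable
    rw [← hsum]
    refine lintegral_congr fun g => ?_
    rw [tsum_eq_single (b g) fun k hk => ?_]
    · simp
    · rw [Set.indicator_of_notMem (by simpa using hk.symm), mul_zero]
  have hbr : Measurable fun g => (b g : ℝ) := measurable_from_top.comp hb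
  rw [hsplit _ (by fun_prop), hsplit _ (by fun_prop)]
  refine tsum_congr fun k => ?_
  have hk : 0 ≤ c * (k : ℝ) := by positivity
  have hind : Measurable ((b ⁻¹' {k}).indicator (1 : (Fin n → ℂ) → ℝ≥0∞)) :=
    measurable_one.indicator (hb (measurableSet_singleton k))
  have h := lintegral_exp_neg_sqNorm_mul hk hind fun r g hr => by
    classical
    rw [Set.indicator_apply, Set.indicator_apply, Set.mem_preimage, Set.mem_preimage, hhom r g hr,
      Pi.one_apply, Pi.one_apply]
  rw [← lintegral_const_mul _ hind] at h
  convert! h using 2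
  · ext g
    by_cases hg : g ∈ b ⁻¹' {k}
    · rw [Set.mem_preimage, Set.mem_singleton_iff] at hg; rw [hg]
    · simp [Set.indicator_of_notMem hg]
  · ext g
    by_cases hg : g ∈ b ⁻¹' {k}
    · rw [Set.mem_preimage, Set.mem_singleton_iff] at hg; rw [hg]
    · simp [Set.indicator_of_notMem hg]

/-- Independence of norm and direction: the squared norm of a Rayleigh vector can be integrated out
first. -/
lemma lintegral_exp_neg_mul_sqNorm {n : ℕ} {b : (Fin n → ℂ) → ℝ} (hb : Measurable b)
    (hb0 : ∀ g, 0 ≤ b g) (hhom : ∀ (r : ℝ) g, 0 < r → b (r • g) = b g) :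
    ∫⁻ g, ENNReal.ofReal (Real.exp (-(b g * sqNorm g))) ∂rayleighVector n =
      ∫⁻ g, ENNReal.ofReal ((1 + b g)⁻¹ ^ n) ∂rayleighVector n := by
  -- `⌊b N⌋ / N` takes countably many values, inherits the invariance of `b` and converges to it;
  -- both integrands are bounded by `1`.
  set d : ℕ → (Fin n → ℂ) → ℕ := fun N g => ⌊b g * N⌋₊
  have hd : ∀ N, Measurable (d N) := fun N => Nat.measurable_floor.comp (hb.mul_const _)
  have hdr : ∀ N, Measurable fun g => (d N g : ℝ) := fun N => measurable_from_top.comp (hd N)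
  have hlim : ∀ g, Filter.Tendsto (fun N : ℕ => (N : ℝ)⁻¹ * d N g) Filter.atTop (nhds (b g)) := by
    intro g
    refine ((tendsto_nat_floor_mul_div_atTop (hb0 g)).comp
      (tendsto_natCast_atTop_atTop (R := ℝ))).congr fun N => ?_
    simp [d, div_eq_inv_mul]
  refine tendsto_nhds_unique (l := Filter.atTop) (f := fun N : ℕ => ∫⁻ g,
    ENNReal.ofReal (Real.exp (-((N : ℝ)⁻¹ * d N g * sqNorm g))) ∂rayleighVector n) ?_ ?_
  · refine tendsto_lintegral_of_dominated_convergence (fun _ => 1) (fun N => by fun_prop)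
      (fun N => .of_forall fun g => ?_) (by simp) (.of_forall fun g => ?_)
    · rw [← ENNReal.ofReal_one]
      refine ENNReal.ofReal_le_ofReal (Real.exp_le_one_iff.2 ?_)
      have := sqNorm_nonneg g
      rw [neg_nonpos]; positivity
    · exact ENNReal.tendsto_ofReal
        ((Real.continuous_exp.tendsto _).comp ((hlim g).mul_const _).neg)
  · have heq : ∀ N : ℕ, ∫⁻ g,
        ENNReal.ofReal (Real.exp (-((N : ℝ)⁻¹ * d N g * sqNorm g))) ∂rayleighVector n =
        ∫⁻ g, ENNReal.ofReal ((1 + (N : ℝ)⁻¹ * d N g)⁻¹ ^ n) ∂rayleighVector n := fun N =>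
      lintegral_exp_neg_mul_sqNorm_of_countable (by positivity) (hd N) fun r g hr => by
        simp only [d, hhom r g hr]
    simp_rw [heq]
    refine tendsto_lintegral_of_dominated_convergence (fun _ => 1) (fun N => by fun_prop)
      (fun N => .of_forall fun g => ?_) (by simp) (.of_forall fun g => ?_)
    · rw [← ENNReal.ofReal_one]
      refine ENNReal.ofReal_le_ofReal (pow_le_one₀ (by positivity) (inv_le_one_of_one_le₀ ?_))
      have : 0 ≤ (N : ℝ)⁻¹ * d N g := by positivity
      linarith
    · refine ENNReal.tendsto_ofReal ((((hlim g).const_add 1).inv₀ ?_).pow n)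
      have := hb0 g
      positivity

/-! ### The leakage gain -/

/-- The power `-n` is the Laplace transform of the squared norm of a Rayleigh vector in `ℂⁿ`. Giving
`v` such a norm turns it into a Rayleigh vector `g`, and `g w` is complex Gaussian for each unit
`w`. -/
lemma lintegral_isotropicUnitVector_inv_pow {n : ℕ} (hn : 1 ≤ n) {c : ℝ} (hc : 0 ≤ c) :
    ∫⁻ w, ∫⁻ v, ENNReal.ofReal ((1 + c * beamGain v w)⁻¹ ^ n) ∂isotropicUnitVector n
      ∂isotropicUnitVector n = ENNReal.ofReal (1 + c)⁻¹ := by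
  have hmw := fun w : Fin n → ℂ => measurable_beamGain_left w
  have key : ∀ w : Fin n → ℂ, sqNorm w = 1 →
      ∫⁻ v, ENNReal.ofReal ((1 + c * beamGain v w)⁻¹ ^ n) ∂isotropicUnitVector n =
        ENNReal.ofReal (1 + c)⁻¹ := by
    intro w hw
    have := hmw w
    rw [isotropicUnitVector_eq_map, lintegral_map (by fun_prop) measurable_direction,
      ← lintegral_exp_neg_mul_sqNorm (b := fun g => c * beamGain (direction g) w)
        ((hmw w).comp measurable_direction |>.const_mul c)
        (fun g => mul_nonneg hc (beamGain_nonneg _ _))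
        (fun r g hr => by rw [direction_smul hr]),
      ← lintegral_exp_neg_norm_sq_stdComplexGaussian hc]
    simp_rw [mul_assoc, beamGain_direction_mul_sqNorm]
    rw [← lintegral_map (μ := rayleighVector n) (g := fun g => beamGain g w)
      (f := fun x => ENNReal.ofReal (Real.exp (-(c * x)))) (by fun_prop) (hmw w),
      rayleighVector_map_beamGain hw, lintegral_map (by fun_prop) (by fun_prop)]
  rw [lintegral_congr_ae ((ae_sqNorm_isotropicUnitVector hn).mono key)]
  simp

lemma two_pow_mul_quantDelta_pow {M : ℕ} (hM : 2 ≤ M) (B : ℕ) :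
    (2 : ℝ) ^ B * quantDelta M B ^ (M - 1) = 1 := by
  have h1 : (M : ℝ) - 1 ≠ 0 := by
    have : (2 : ℝ) ≤ M := by exact_mod_cast hM
    linarith
  rw [quantDelta, ← Real.rpow_natCast _ (M - 1), ← Real.rpow_mul (by norm_num), Nat.cast_sub
    (by omega), Nat.cast_one, div_mul_cancel₀ _ h1, Real.rpow_neg (by norm_num), Real.rpow_natCast,
    mul_inv_cancel₀ (by positivity)]

lemma quantDelta_pos (M B : ℕ) : 0 < quantDelta M B := Real.rpow_pos_of_pos two_pos _

lemma ae_nonneg_quantErrorLaw (M B : ℕ) : ∀ᵐ x ∂quantErrorLaw M B, 0 ≤ x :=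
  (withDensity_absolutelyContinuous _ _).ae_le
    ((ae_restrict_iff' measurableSet_Icc).2 (.of_forall fun _ hx => hx.1))

instance (M B : ℕ) : SFinite (quantErrorLaw M B) := by unfold quantErrorLaw; infer_instance

instance (M B n : ℕ) : SFinite ((quantErrorLaw M B).prod
    ((isotropicUnitVector n).prod (isotropicUnitVector n))) :=
  Measure.prod.instSFinite

/-- The density times `(1 + ax)^{-M}` has the primitive `2^B (x / (1 + ax))^{M-1}`, and `2^B δ^{M-1}
= 1`. The exponent drops to `M - 1`, the dimension in which `v` and `w` live. -/
lemma lintegral_quantErrorLaw_inv_pow {M : ℕ} (hM : 2 ≤ M) (B : ℕ) {a : ℝ} (ha : 0 ≤ a) :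
    ∫⁻ x, ENNReal.ofReal ((1 + a * x)⁻¹ ^ M) ∂quantErrorLaw M B =
      ENNReal.ofReal ((1 + a * quantDelta M B)⁻¹ ^ (M - 1)) := by
  -- This removes the truncated subtractions in the exponents `M - 2` and `M - 1`.
  obtain ⟨N, rfl⟩ : ∃ N, M = N + 2 := ⟨M - 2, by omega⟩
  have hδ := quantDelta_pos (N + 2) B
  have hone := two_pow_mul_quantDelta_pow hM B
  set δ := quantDelta (N + 2) B
  have hpos : ∀ x ∈ Set.Icc 0 δ, 0 < 1 + a * x := fun x hx => by
    have := mul_nonneg ha hx.1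
    linarith
  set G' : ℝ → ℝ := fun x => 2 ^ B * (N + 1) * x ^ N * (1 + a * x)⁻¹ ^ (N + 2)
  have hderiv : ∀ x ∈ Set.Icc 0 δ,
      HasDerivAt (fun x => 2 ^ B * (x * (1 + a * x)⁻¹) ^ (N + 1)) (G' x) x := by
    intro x hx
    have hx0 := (hpos x hx).ne'
    have h1 : HasDerivAt (fun x => 1 + a * x) a x := by
      simpa using ((hasDerivAt_id x).const_mul a).const_add 1
    have h2 := (((hasDerivAt_id x).mul (h1.inv hx0)).pow (N + 1)).const_mul ((2 : ℝ) ^ B)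
    convert! h2 using 1
    simp only [G', id, Pi.mul_apply, Pi.inv_apply, Nat.add_sub_cancel]
    push_cast
    rw [mul_pow, show (1 + a * x)⁻¹ ^ (N + 2) = (1 + a * x)⁻¹ ^ N * (1 + a * x)⁻¹ ^ 2 from
      pow_add _ _ _]
    have h3 : 1 * (1 + a * x)⁻¹ + x * (-a / (1 + a * x) ^ 2) = (1 + a * x)⁻¹ ^ 2 := by
      field_simp
      ring
    rw [h3]
    ring
  have hcont : ContinuousOn G' (Set.Icc 0 δ) := by
    refine ContinuousOn.mul (by fun_prop) (ContinuousOn.pow (ContinuousOn.inv₀ (by fun_prop)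
      fun x hx => (hpos x hx).ne') _)
  have hint : IntegrableOn G' (Set.Icc 0 δ) := hcont.integrableOn_compact isCompact_Icc
  rw [quantErrorLaw, lintegral_withDensity_eq_lintegral_mul _ (by fun_prop) (by fun_prop)]
  have hcongr : ∀ x ∈ Set.Icc 0 δ, ((fun x : ℝ => ENNReal.ofReal
      (2 ^ B * (((N + 2 : ℕ) : ℝ) - 1) * x ^ (N + 2 - 2))) *
      fun x => ENNReal.ofReal ((1 + a * x)⁻¹ ^ (N + 2))) x = ENNReal.ofReal (G' x) := by
    intro x hx
    have hx0 := hx.1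
    rw [Pi.mul_apply, ← ENNReal.ofReal_mul]
    · simp only [G', Nat.add_sub_cancel]
      push_cast
      congr 4
      ring
    · push_cast
      have : (0 : ℝ) ≤ N + 2 - 1 := by linarith [N.cast_nonneg (α := ℝ)]
      positivity
  rw [setLIntegral_congr_fun measurableSet_Icc hcongr, ← ofReal_integral_eq_lintegral_ofReal hint
    ((ae_restrict_iff' measurableSet_Icc).2 (.of_forall fun x hx => ?_)), integral_Icc_eq_integral_Ioc,
    ← intervalIntegral.integral_of_le hδ.le, intervalIntegral.integral_eq_sub_of_hasDerivAt
      (fun x hx => hderiv x (by rwa [Set.uIcc_of_le hδ.le] at hx))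
      ((intervalIntegrable_iff_integrableOn_Icc_of_le hδ.le).2 hint)]
  · congr 1
    rw [show N + 2 - 1 = N + 1 by omega] at hone ⊢
    rw [mul_pow, ← mul_assoc, hone]
    simp
  · have := hpos x hx
    have := hx.1
    simp only [G', Pi.zero_apply]
    positivity

@[fun_prop]
lemma measurable_leakage (M N : ℕ) : Measurable
    (fun p : (Fin M → ℂ) × ℝ × (Fin N → ℂ) × (Fin N → ℂ) =>
      sqNorm p.1 * p.2.1 * beamGain p.2.2.1 p.2.2.2) :=
  ((measurable_sqNorm.comp measurable_fst).mul (by fun_prop)).mul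
    (measurable_beamGain.comp (by fun_prop))

lemma ae_nonneg_leakageGainLaw (M B : ℕ) : ∀ᵐ x ∂leakageGainLaw M B, 0 ≤ x := by
  rw [leakageGainLaw, ae_map_iff (measurable_leakage M (M - 1)).aemeasurable measurableSet_Ici]
  have h : ∀ᵐ p ∂(rayleighVector M).prod ((quantErrorLaw M B).prod
      ((isotropicUnitVector (M - 1)).prod (isotropicUnitVector (M - 1)))), 0 ≤ p.2.1 :=
    Measure.quasiMeasurePreserving_snd.ae
      (Measure.quasiMeasurePreserving_fst.ae (ae_nonneg_quantErrorLaw M B))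
  filter_upwards [h] with p hp
  exact mul_nonneg (mul_nonneg (sqNorm_nonneg _) hp) (beamGain_nonneg _ _)

/-- The leakage is exponential with mean `δ`. -/
lemma lintegral_exp_neg_leakageGainLaw {M : ℕ} (hM : 2 ≤ M) (B : ℕ) {t : ℝ} (ht : 0 ≤ t) :
    ∫⁻ x, ENNReal.ofReal (Real.exp (-(t * x))) ∂leakageGainLaw M B =
      ENNReal.ofReal (1 + t * quantDelta M B)⁻¹ := by
  rw [leakageGainLaw, lintegral_map (by fun_prop) (measurable_leakage M (M - 1)),
    lintegral_prod_symm _ (by fun_prop)]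
  -- The norm is integrated first, then the quantization error, then the two directions; the
  -- exponents are `M`, `M - 1`, `1`.
  have h1 : ∀ᵐ q ∂(quantErrorLaw M B).prod
      ((isotropicUnitVector (M - 1)).prod (isotropicUnitVector (M - 1))),
      ∫⁻ h, ENNReal.ofReal (Real.exp (-(t * (sqNorm h * q.1 * beamGain q.2.1 q.2.2))))
        ∂rayleighVector M =
      ENNReal.ofReal ((1 + t * beamGain q.2.1 q.2.2 * q.1)⁻¹ ^ M) := by
    filter_upwards [Measure.quasiMeasurePreserving_fst.ae (ae_nonneg_quantErrorLaw M B)] with q hq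
    rw [← lintegral_exp_neg_sqNorm M
      (mul_nonneg (mul_nonneg ht (beamGain_nonneg q.2.1 q.2.2)) hq)]
    refine lintegral_congr fun h => ?_
    congr 3; ring
  have hm2 : Measurable fun q : ℝ × (Fin (M - 1) → ℂ) × (Fin (M - 1) → ℂ) =>
      beamGain q.2.1 q.2.2 := measurable_beamGain.comp (by fun_prop)
  rw [lintegral_congr_ae h1, lintegral_prod_symm _ (by fun_prop)]
  simp_rw [fun q : (Fin (M - 1) → ℂ) × (Fin (M - 1) → ℂ) =>
    lintegral_quantErrorLaw_inv_pow hM B (mul_nonneg ht (beamGain_nonneg q.1 q.2))]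
  rw [lintegral_prod_symm _ (by fun_prop), ← lintegral_isotropicUnitVector_inv_pow
    (n := M - 1) (by omega) (mul_nonneg ht (quantDelta_pos M B).le)]
  refine lintegral_congr fun w => lintegral_congr fun v => ?_
  congr 4; ring

end

noncomputable section

/-! ### The interference constant -/

lemma lintegral_rpow_mul_exp_neg_mul_Ioi {c r : ℝ} (hc : 0 < c) (hr : 0 < r) :
    ∫⁻ x in Set.Ioi 0, ENNReal.ofReal (x ^ (c - 1) * Real.exp (-(r * x))) =
      ENNReal.ofReal ((1 / r) ^ c * Real.Gamma c) := by
  have h := Real.integral_rpow_mul_exp_neg_mul_Ioi hc hr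
  have hpos : 0 < (1 / r) ^ c * Real.Gamma c :=
    mul_pos (Real.rpow_pos_of_pos (by positivity) _) (Real.Gamma_pos_of_pos hc)
  rw [← h, ofReal_integral_eq_lintegral_ofReal (Integrable.of_integral_ne_zero (h ▸ hpos.ne'))]
  refine (ae_restrict_iff' measurableSet_Ioi).2 (.of_forall fun x hx => ?_)
  have : (0 : ℝ) < x := hx
  simp only [Pi.zero_apply]
  positivity

/-- The Beta function as an integral over the half line. -/
lemma lintegral_rpow_mul_one_add_rpow_Ioi {a b : ℝ} (ha : 0 < a) (hb : 0 < b) :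
    ∫⁻ t in Set.Ioi 0, ENNReal.ofReal (t ^ (a - 1) * (1 / (1 + t)) ^ (a + b)) =
      ENNReal.ofReal (beta a b) := by
  have hab : 0 < a + b := by linarith
  have hG : 0 < Real.Gamma (a + b) := Real.Gamma_pos_of_pos hab
  have key : ENNReal.ofReal (Real.Gamma (a + b)) *
      ∫⁻ t in Set.Ioi 0, ENNReal.ofReal (t ^ (a - 1) * (1 / (1 + t)) ^ (a + b)) =
      ENNReal.ofReal (Real.Gamma a * Real.Gamma b) := by
    -- `Γ(a+b) (1+t)^{-(a+b)}` is a Gamma integral in `x`; exchanging the integrals leaves one Gamma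
    -- integral in `t` and one in `x`.
    rw [← lintegral_const_mul _ (by fun_prop)]
    calc ∫⁻ t in Set.Ioi 0, ENNReal.ofReal (Real.Gamma (a + b)) *
          ENNReal.ofReal (t ^ (a - 1) * (1 / (1 + t)) ^ (a + b))
        = ∫⁻ t in Set.Ioi 0, ∫⁻ x in Set.Ioi 0, ENNReal.ofReal (t ^ (a - 1)) *
            ENNReal.ofReal (x ^ (a + b - 1) * Real.exp (-((1 + t) * x))) := by
          refine setLIntegral_congr_fun measurableSet_Ioi fun t ht => ?_
          have ht' : (0 : ℝ) < t := ht
          rw [lintegral_const_mul _ (by fun_prop),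
            lintegral_rpow_mul_exp_neg_mul_Ioi hab (by linarith), ← ENNReal.ofReal_mul hG.le,
            ← ENNReal.ofReal_mul (by positivity)]
          congr 1; ring
      _ = ∫⁻ x in Set.Ioi 0, ∫⁻ t in Set.Ioi 0, ENNReal.ofReal (t ^ (a - 1)) *
            ENNReal.ofReal (x ^ (a + b - 1) * Real.exp (-((1 + t) * x))) :=
          lintegral_lintegral_swap (by fun_prop)
      _ = ∫⁻ x in Set.Ioi 0, ENNReal.ofReal (Real.Gamma a) *
            ENNReal.ofReal (x ^ (b - 1) * Real.exp (-(1 * x))) := by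
          refine setLIntegral_congr_fun measurableSet_Ioi fun x hx => ?_
          have hx' : (0 : ℝ) < x := hx
          have h1 : ∫⁻ t in Set.Ioi 0, ENNReal.ofReal (t ^ (a - 1)) *
              ENNReal.ofReal (x ^ (a + b - 1) * Real.exp (-((1 + t) * x))) =
              ∫⁻ t in Set.Ioi 0, ENNReal.ofReal (x ^ (a + b - 1) * Real.exp (-x)) *
                ENNReal.ofReal (t ^ (a - 1) * Real.exp (-(x * t))) := by
            refine setLIntegral_congr_fun measurableSet_Ioi fun t ht => ?_
            have ht' : (0 : ℝ) < t := ht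
            rw [← ENNReal.ofReal_mul (by positivity), ← ENNReal.ofReal_mul (by positivity),
              show -((1 + t) * x) = -x + -(x * t) by ring, Real.exp_add]
            congr 1; ring
          rw [h1, lintegral_const_mul _ (by fun_prop), lintegral_rpow_mul_exp_neg_mul_Ioi ha hx',
            ← ENNReal.ofReal_mul (by positivity),
            ← ENNReal.ofReal_mul (Real.Gamma_pos_of_pos ha).le]
          congr 1
          rw [one_div, Real.inv_rpow hx'.le, show a + b - 1 = a + (b - 1) by ring,
            Real.rpow_add hx', one_mul]
          have := (Real.rpow_pos_of_pos hx' a).ne'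
          field_simp
      _ = ENNReal.ofReal (Real.Gamma a * Real.Gamma b) := by
          rw [lintegral_const_mul _ (by fun_prop), lintegral_rpow_mul_exp_neg_mul_Ioi hb one_pos,
            ← ENNReal.ofReal_mul (Real.Gamma_pos_of_pos ha).le]
          simp
  rw [beta, ENNReal.ofReal_div_of_pos hG, ← key, mul_comm, ENNReal.mul_div_cancel_right]
  · exact (ENNReal.ofReal_pos.2 hG).ne'
  · exact ENNReal.ofReal_ne_top

/-- Integration of radial functions over the plane. -/
lemma lintegral_plane_norm {F : ℝ → ℝ≥0∞} (hF : Measurable F) :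
    ∫⁻ x : Plane, F ‖x‖ =
      ENNReal.ofReal (2 * Real.pi) * ∫⁻ u in Set.Ioi 0, ENNReal.ofReal u * F u := by
  have h1 : ∫⁻ x : Plane, F ‖x‖ = ∫⁻ z : ℂ, F ‖z‖ := by
    have hp := Complex.orthonormalBasisOneI.measurePreserving_repr
    rw [← hp.lintegral_comp (f := fun x : Plane => F ‖x‖) (by fun_prop)]
    simp only [LinearIsometryEquiv.norm_map]
  rw [h1, ← Complex.lintegral_comp_polarCoord_symm, polarCoord_target, Measure.volume_eq_prod,
    ← Measure.prod_restrict]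
  simp_rw [Complex.norm_polarCoord_symm, smul_eq_mul]
  rw [lintegral_prod _ (by fun_prop), ← lintegral_const_mul _ (by fun_prop)]
  refine setLIntegral_congr_fun measurableSet_Ioi fun u hu => ?_
  have hu' : (0 : ℝ) < u := hu
  dsimp only
  rw [setLIntegral_const, Real.volume_Ioo, abs_of_pos hu', mul_comm]
  congr 2
  ring

/-- The subtracted term is `t^K / (1+t)^K`, the top term of the binomial expansion of `(1+t)^K`.
Hence the sum over `m < K` in the interference constant. -/
lemma one_sub_inv_one_add_inv_pow (K : ℕ) {t : ℝ} (ht : 0 < t) :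
    1 - (1 + t⁻¹)⁻¹ ^ K =
      ∑ m ∈ Finset.range K, (K.choose m : ℝ) * (t ^ m * (1 / (1 + t)) ^ K) := by
  have h1 : (0 : ℝ) < 1 + t := by linarith
  have h := add_pow t 1 K
  rw [Finset.sum_range_succ] at h
  simp only [one_pow, mul_one, Nat.choose_self, Nat.cast_one] at h
  have h2 : ∑ m ∈ Finset.range K, (K.choose m : ℝ) * (t ^ m * (1 / (1 + t)) ^ K) =
      (∑ m ∈ Finset.range K, t ^ m * (K.choose m : ℝ)) * (1 / (1 + t)) ^ K := by
    rw [Finset.sum_mul]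
    exact Finset.sum_congr rfl fun m _ => by ring
  have h3 : ∑ m ∈ Finset.range K, t ^ m * (K.choose m : ℝ) = (1 + t) ^ K - t ^ K := by
    rw [add_comm 1 t, h]; ring
  have h4 : (1 + t⁻¹)⁻¹ = t * (1 / (1 + t)) := by field_simp; ring
  rw [h2, h3, h4, mul_pow, sub_mul, ← mul_pow (1 + t), mul_one_div_cancel h1.ne', one_pow]

/-- Here `α > 2` enters: `2/α < 1` makes the second Beta argument positive up to `m = K - 1`. -/
lemma beta_interference_pos {K m : ℕ} {α : ℝ} (hα : 2 < α) (hm : m < K) :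
    0 < (m : ℝ) + 2 / α ∧ 0 < (K : ℝ) - m - 2 / α := by
  have h1 : 0 < 2 / α := by positivity
  have h2 : 2 / α < 1 := by rw [div_lt_one (by linarith)]; exact hα
  have h3 : (m : ℝ) + 1 ≤ K := by exact_mod_cast hm
  have h4 : (0 : ℝ) ≤ m := m.cast_nonneg
  constructor <;> linarith

lemma interferenceConst_pos {K : ℕ} (hK : 1 ≤ K) {α : ℝ} (hα : 2 < α) :
    0 < interferenceConst K α := by
  refine mul_pos (by positivity) (Finset.sum_pos (fun m hm => ?_) ⟨0, Finset.mem_range.2 hK⟩)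
  have hm' := Finset.mem_range.1 hm
  obtain ⟨h1, h2⟩ := beta_interference_pos hα hm'
  exact mul_pos (by exact_mod_cast Nat.choose_pos hm'.le) (beta_pos h1 h2)

lemma lintegral_rpow_mul_one_sub_Ioi (K : ℕ) {α : ℝ} (hα : 2 < α) :
    ∫⁻ t in Set.Ioi 0, ENNReal.ofReal (t ^ (2 / α - 1) * (1 - (1 + t⁻¹)⁻¹ ^ K)) =
      ENNReal.ofReal (∑ m ∈ Finset.range K,
        (K.choose m : ℝ) * beta (m + 2 / α) (K - m - 2 / α)) := by
  have h1 : ∀ t ∈ Set.Ioi (0 : ℝ), ENNReal.ofReal (t ^ (2 / α - 1) * (1 - (1 + t⁻¹)⁻¹ ^ K)) =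
      ∑ m ∈ Finset.range K, ENNReal.ofReal (K.choose m) * ENNReal.ofReal
        (t ^ (m + 2 / α - 1) * (1 / (1 + t)) ^ ((m + 2 / α) + (K - m - 2 / α))) := by
    intro t ht
    have ht' : (0 : ℝ) < t := ht
    rw [one_sub_inv_one_add_inv_pow K ht', Finset.mul_sum, ENNReal.ofReal_sum_of_nonneg
      fun m _ => by positivity]
    refine Finset.sum_congr rfl fun m _ => ?_
    rw [← ENNReal.ofReal_mul (by positivity)]
    congr 1
    rw [show (m + 2 / α) + (K - m - 2 / α) = (K : ℝ) by ring, Real.rpow_natCast,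
      show (m + 2 / α - 1) = (2 / α - 1) + (m : ℝ) by ring, Real.rpow_add ht', Real.rpow_natCast]
    ring
  rw [setLIntegral_congr_fun measurableSet_Ioi h1, lintegral_finsetSum _ fun m _ => by fun_prop,
    ENNReal.ofReal_sum_of_nonneg]
  · refine Finset.sum_congr rfl fun m hm => ?_
    obtain ⟨h2, h3⟩ := beta_interference_pos hα (Finset.mem_range.1 hm)
    rw [lintegral_const_mul _ (by fun_prop), lintegral_rpow_mul_one_add_rpow_Ioi h2 h3,
      ← ENNReal.ofReal_mul (by positivity)]
  · intro m hm
    obtain ⟨h2, h3⟩ := beta_interference_pos hα (Finset.mem_range.1 hm)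
    exact mul_nonneg (by positivity) (beta_pos h2 h3).le

lemma image_mul_rpow_Ioi {ζ p : ℝ} (hζ : 0 < ζ) (hp : 0 < p) :
    (fun t : ℝ => (ζ * t) ^ p) '' Set.Ioi 0 = Set.Ioi 0 := by
  ext u
  constructor
  · rintro ⟨t, ht, rfl⟩
    have : (0 : ℝ) < t := ht
    exact Real.rpow_pos_of_pos (by positivity) _
  · intro hu
    have hu' : (0 : ℝ) < u := hu
    refine ⟨ζ⁻¹ * u ^ p⁻¹, by simp only [Set.mem_Ioi]; positivity, ?_⟩
    beta_reduce
    rw [mul_inv_cancel_left₀ hζ.ne', ← Real.rpow_mul hu'.le, inv_mul_cancel₀ hp.ne', Real.rpow_one]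

/-- The integral of the interference kernel over the plane. -/
lemma lintegral_plane_interference (K : ℕ) {α ζ : ℝ} (hα : 2 < α) (hζ : 0 < ζ) (r : Plane) :
    ∫⁻ x : Plane, ENNReal.ofReal (1 - (1 + ζ * ‖x - r‖ ^ (-α))⁻¹ ^ K) =
      ENNReal.ofReal (interferenceConst K α * ζ ^ (2 / α)) := by
  have hα0 : 0 < α := by linarith
  rw [lintegral_sub_right_eq_self
    (fun x : Plane => ENNReal.ofReal (1 - (1 + ζ * ‖x‖ ^ (-α))⁻¹ ^ K)) r,
    lintegral_plane_norm (F := fun u => ENNReal.ofReal (1 - (1 + ζ * u ^ (-α))⁻¹ ^ K))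
      (by fun_prop)]
  have hp : 0 < α⁻¹ := inv_pos.2 hα0
  -- The substitution `u = (ζ t)^{1/α}` turns `ζ u^{-α}` into `t⁻¹` and lets `ζ^{2/α}` come out as a
  -- factor.
  have hderiv : ∀ t ∈ Set.Ioi (0 : ℝ), HasDerivWithinAt (fun t : ℝ => (ζ * t) ^ α⁻¹)
      (ζ * α⁻¹ * (ζ * t) ^ (α⁻¹ - 1)) (Set.Ioi 0) t := by
    intro t ht
    have ht' : (0 : ℝ) < t := ht
    have h := ((hasDerivAt_id t).const_mul ζ).rpow_const (p := α⁻¹)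
      (Or.inl (mul_pos hζ ht').ne')
    simpa using h.hasDerivWithinAt
  have hinj : Set.InjOn (fun t : ℝ => (ζ * t) ^ α⁻¹) (Set.Ioi 0) := by
    intro s hs t ht hst
    have hs' : (0 : ℝ) < s := hs
    have ht' : (0 : ℝ) < t := ht
    exact mul_left_cancel₀ hζ.ne' ((Real.rpow_left_inj (mul_pos hζ hs').le (mul_pos hζ ht').le
      hp.ne').1 hst)
  have hsub := lintegral_image_eq_lintegral_abs_deriv_mul measurableSet_Ioi hderiv hinj
    (fun u => ENNReal.ofReal u * ENNReal.ofReal (1 - (1 + ζ * u ^ (-α))⁻¹ ^ K))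
  rw [image_mul_rpow_Ioi hζ hp] at hsub
  rw [hsub]
  have hpt : ∀ t ∈ Set.Ioi (0 : ℝ), ENNReal.ofReal |ζ * α⁻¹ * (ζ * t) ^ (α⁻¹ - 1)| *
      (ENNReal.ofReal ((ζ * t) ^ α⁻¹) *
        ENNReal.ofReal (1 - (1 + ζ * ((ζ * t) ^ α⁻¹) ^ (-α))⁻¹ ^ K)) =
      ENNReal.ofReal (α⁻¹ * ζ ^ (2 / α)) *
        ENNReal.ofReal (t ^ (2 / α - 1) * (1 - (1 + t⁻¹)⁻¹ ^ K)) := by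
    intro t ht
    have ht' : (0 : ℝ) < t := ht
    have hζt : 0 < ζ * t := mul_pos hζ ht'
    rw [abs_of_pos (by positivity), ← ENNReal.ofReal_mul (by positivity),
      ← ENNReal.ofReal_mul (by positivity), ← ENNReal.ofReal_mul (by positivity)]
    congr 1
    have e1 : ζ * ((ζ * t) ^ α⁻¹) ^ (-α) = t⁻¹ := by
      rw [← Real.rpow_mul hζt.le, mul_neg, inv_mul_cancel₀ hα0.ne', Real.rpow_neg_one]
      field_simp
    have e2 : (ζ * t) ^ (α⁻¹ - 1) * (ζ * t) ^ α⁻¹ = ζ ^ (2 / α - 1) * t ^ (2 / α - 1) := by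
      rw [← Real.rpow_add hζt, ← Real.mul_rpow hζ.le ht'.le]
      congr 1; ring
    have e3 : ζ ^ (2 / α) = ζ * ζ ^ (2 / α - 1) := by
      rw [Real.rpow_sub_one hζ.ne']
      field_simp
    rw [e1, e3]
    calc _ = ζ * α⁻¹ * ((ζ * t) ^ (α⁻¹ - 1) * (ζ * t) ^ α⁻¹) * (1 - (1 + t⁻¹)⁻¹ ^ K) := by ring
      _ = _ := by rw [e2]; ring
  rw [setLIntegral_congr_fun measurableSet_Ioi hpt, lintegral_const_mul _ (by fun_prop),
    lintegral_rpow_mul_one_sub_Ioi K hα, ← ENNReal.ofReal_mul (by positivity),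
    ← ENNReal.ofReal_mul (by positivity)]
  congr 1
  unfold interferenceConst
  ring

end

noncomputable section

/-! ### An exponential signal against independent interference -/

/-- Writing each factor as an exponential turns the infinite product over interferers into a sum in
`[0, ∞]`. -/
lemma expNeg_log_one_add {w : ℝ} (hw : 0 ≤ w) :
    expNeg (ENNReal.ofReal (Real.log (1 + w))) = ENNReal.ofReal (1 + w)⁻¹ := by
  rw [expNeg_ofReal (Real.log_nonneg (by linarith)), Real.exp_neg, Real.exp_log (by linarith)]

lemma lintegral_expNeg_ofReal_mul {ν : Measure ℝ} (hν : ∀ᵐ x ∂ν, 0 ≤ x) {w m : ℝ} (hw : 0 ≤ w)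
    (hm : 0 ≤ m)
    (h : ∫⁻ x, ENNReal.ofReal (Real.exp (-(w * x))) ∂ν = ENNReal.ofReal (1 + w * m)⁻¹) :
    ∫⁻ x, expNeg (ENNReal.ofReal (w * x)) ∂ν =
      expNeg (ENNReal.ofReal (Real.log (1 + w * m))) := by
  rw [expNeg_log_one_add (mul_nonneg hw hm), ← h]
  exact lintegral_congr_ae (hν.mono fun x hx => expNeg_ofReal (mul_nonneg hw hx))

/-- A level `Z` independent of an exponential variable `Y` is exceeded by it with probability
`E e^{-Z}`. -/
lemma measure_lt_ofReal_of_indepFun {Ω : Type*} [MeasurableSpace Ω] {μ : Measure Ω}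
    [IsProbabilityMeasure μ] {Y : Ω → ℝ} {Z : Ω → ℝ≥0∞} (hY : Measurable Y) (hZ : Measurable Z)
    (hYZ : IndepFun Y Z μ)
    (htail : ∀ t : ℝ, 0 ≤ t → μ.map Y (Set.Ioi t) = ENNReal.ofReal (Real.exp (-t))) :
    μ {ω | Z ω < ENNReal.ofReal (Y ω)} = ∫⁻ ω, expNeg (Z ω) ∂μ := by
  have hS : MeasurableSet {p : ℝ × ℝ≥0∞ | p.2 < ENNReal.ofReal p.1} :=
    measurableSet_lt (by fun_prop) (by fun_prop)
  have h1 : μ {ω | Z ω < ENNReal.ofReal (Y ω)} =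
      μ.map (fun ω => (Y ω, Z ω)) {p : ℝ × ℝ≥0∞ | p.2 < ENNReal.ofReal p.1} := by
    rw [Measure.map_apply (hY.prodMk hZ) hS]; rfl
  have hpY := Measure.isProbabilityMeasure_map (μ := μ) hY.aemeasurable
  have hpZ := Measure.isProbabilityMeasure_map (μ := μ) hZ.aemeasurable
  rw [h1, (indepFun_iff_map_prod_eq_prod_map_map hY.aemeasurable hZ.aemeasurable).1 hYZ,
    Measure.prod_apply_symm hS, ← lintegral_map measurable_expNeg hZ]
  refine lintegral_congr fun z => ?_
  induction z with
  | top =>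
    have : (fun a : ℝ => (a, (∞ : ℝ≥0∞))) ⁻¹' {p : ℝ × ℝ≥0∞ | p.2 < ENNReal.ofReal p.1} = ∅ := by
      ext a; simp
    rw [this, measure_empty, expNeg_top]
  | coe t =>
    have : (fun a : ℝ => (a, (t : ℝ≥0∞))) ⁻¹' {p : ℝ × ℝ≥0∞ | p.2 < ENNReal.ofReal p.1} =
        Set.Ioi (t : ℝ) := by
      ext a
      rw [← ENNReal.ofReal_coe_nnreal]
      exact ENNReal.ofReal_lt_ofReal_iff_of_nonneg t.2
    rw [this, htail t t.coe_nonneg, ← expNeg_ofReal t.coe_nonneg, ENNReal.ofReal_coe_nnreal]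

lemma measurable_add_tsum {Ω S : Type*} {_ : MeasurableSpace Ω} [Countable S] (c : ℝ≥0∞)
    {f : S → Ω → ℝ≥0∞} (hf : ∀ s, Measurable (f s)) : Measurable fun ω => c + ∑' s, f s ω :=
  Measurable.const_add (Measurable.tsum hf) c

/-- Since `φ s₀ = 0`, the sum is measurable for the σ-algebra generated by the other variables. -/
lemma indepFun_add_tsum {Ω S : Type*} [MeasurableSpace Ω] [Countable S] {μ : Measure Ω}
    {g : S → Ω → ℝ} (hg : ∀ s, Measurable (g s)) (hind : iIndepFun g μ) (s₀ : S) (c : ℝ≥0∞)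
    {φ : S → ℝ → ℝ≥0∞} (hφ : ∀ s, Measurable (φ s)) (hφ0 : φ s₀ = 0) :
    IndepFun (g s₀) (fun ω => c + ∑' s, φ s (g s ω)) μ := by
  have h := indep_iSup_of_disjoint (fun s => (hg s).comap_le) hind.iIndep
    (S := {s₀}) (T := {s₀}ᶜ) (Set.disjoint_compl_right_iff_subset.2 subset_rfl)
  rw [IndepFun_iff_Indep]
  refine indep_of_indep_of_le h ?_ ?_
  · exact le_iSup₂_of_le (f := fun i (_ : i ∈ ({s₀} : Set S)) => MeasurableSpace.comap (g i) _)
      s₀ rfl le_rfl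
  · rw [← measurable_iff_comap_le]
    refine measurable_add_tsum c fun s => ?_
    by_cases hs : s = s₀
    · subst hs; rw [hφ0]; exact measurable_const
    · refine (hφ s).comp ?_
      rw [measurable_iff_comap_le]
      exact le_iSup₂_of_le
        (f := fun i (_ : i ∈ ({s₀}ᶜ : Set S)) => MeasurableSpace.comap (g i) _) s hs le_rfl

/-- On the canonical space the coordinates are measurable everywhere, whereas the gains are only
a.e. measurable. -/
lemma iIndepFun_eval_map {Ω S : Type*} [MeasurableSpace Ω] [Countable S] {μ : Measure Ω}
    {g : S → Ω → ℝ} (hg : ∀ s, AEMeasurable (g s) μ) (hind : iIndepFun g μ) :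
    iIndepFun (fun s (y : S → ℝ) => y s) (μ.map fun ω s => g s ω) := by
  have := hind.isProbabilityMeasure
  have hG : AEMeasurable (fun ω s => g s ω) μ := aemeasurable_pi_iff.2 hg
  have := Measure.isProbabilityMeasure_map hG
  rw [iIndepFun_iff_map_fun_eq_infinitePi_map₀' fun s => (measurable_pi_apply s).aemeasurable]
  have h1 : ∀ s, (μ.map fun ω s => g s ω).map (fun y : S → ℝ => y s) = μ.map (g s) := fun s =>
    AEMeasurable.map_map_of_aemeasurable (measurable_pi_apply s).aemeasurable hG
  simp_rw [h1]
  rw [← hind.map_fun_eq_infinitePi_map₀' hg]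
  exact Measure.map_id

/-- Success probability of an exponential signal against a countable sum of independent
interference terms. -/
lemma measure_add_tsum_lt_ofReal {Ω S : Type*} [MeasurableSpace Ω] [Countable S] {μ : Measure Ω}
    {g : S → Ω → ℝ} (hg : ∀ s, Measurable (g s)) (hind : iIndepFun g μ) (s₀ : S) (c : ℝ≥0∞)
    {φ : S → ℝ → ℝ≥0∞} (hφ : ∀ s, Measurable (φ s)) (hφ0 : φ s₀ = 0) {l : S → ℝ≥0∞}
    (htail : ∀ t : ℝ, 0 ≤ t → μ.map (g s₀) (Set.Ioi t) = ENNReal.ofReal (Real.exp (-t)))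
    (hl : ∀ s, ∫⁻ x, expNeg (φ s x) ∂μ.map (g s) = expNeg (l s)) :
    μ {ω | c + ∑' s, φ s (g s ω) < ENNReal.ofReal (g s₀ ω)} = expNeg (c + ∑' s, l s) := by
  have := hind.isProbabilityMeasure
  have hφg : ∀ s, Measurable fun ω => φ s (g s ω) := fun s => (hφ s).comp (hg s)
  have hsum : Measurable fun ω => expNeg (∑' s, φ s (g s ω)) :=
    measurable_expNeg.comp (Measurable.tsum hφg)
  rw [measure_lt_ofReal_of_indepFun (hg s₀) (measurable_add_tsum c hφg)
    (indepFun_add_tsum hg hind s₀ c hφ hφ0) htail]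
  simp_rw [expNeg_add]
  rw [lintegral_const_mul _ hsum, lintegral_expNeg_tsum
    (fun s => (hφg s).aemeasurable) (hind.comp φ hφ) fun s => ?_]
  rw [← hl s]
  exact (lintegral_map (measurable_expNeg.comp (hφ s)) (hg s)).symm

/-! ### The outage probability -/

namespace ZFNetwork

variable {M K B : ℕ} {r : Fin K → Plane} {lam : ℝ≥0}

/-- The weight of a stream gain in the interference at user `k`, relative to the signal. -/
def weight {K : ℕ} {ι : Type} (r : Fin K → Plane) (α β : ℝ) (k : Fin K) (x : ι → Plane) :
    Option ι × Fin K → ℝ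
  | (none, j) => if j = k then 0 else β
  | (some i, _) => β * ‖r k‖ ^ α * ‖x i - r k‖ ^ (-α)

/-- The exponent of the Laplace transform of a weighted stream gain. -/
def logWeight {K : ℕ} {ι : Type} (M B : ℕ) (r : Fin K → Plane) (α β : ℝ) (k : Fin K)
    (x : ι → Plane) : Option ι × Fin K → ℝ≥0∞
  | (none, j) => if j = k then 0 else ENNReal.ofReal (Real.log (1 + β * quantDelta M B))
  | (some i, _) => ENNReal.ofReal (Real.log (1 + β * ‖r k‖ ^ α * ‖x i - r k‖ ^ (-α)))

lemma weight_nonneg {ι : Type} {α β : ℝ} (hβ : 0 < β) (k : Fin K) (x : ι → Plane)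
    (s : Option ι × Fin K) : 0 ≤ weight r α β k x s := by
  rcases s with ⟨_ | i, j⟩
  · simp only [weight]; split_ifs <;> [exact le_rfl; exact hβ.le]
  · simp only [weight]; positivity

lemma measurable_weight {ι : Type} (α β : ℝ) (k : Fin K) (s : Option ι × Fin K) :
    Measurable fun x : ι → Plane => weight r α β k x s := by
  rcases s with ⟨_ | i, j⟩
  · simp only [weight]; exact measurable_const
  · simp only [weight]
    have : Measurable fun x : ι → Plane => x i := measurable_pi_apply i
    fun_prop

/-- The interference and noise at user `k`, relative to the signal. -/
def relInterference {K : ℕ} {ι : Type} (r : Fin K → Plane) (α ρ σ β : ℝ) (k : Fin K)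
    (g : Option ι × Fin K → ℝ) (x : ι → Plane) : ℝ≥0∞ :=
  ENNReal.ofReal (σ ^ 2 * (β * ‖r k‖ ^ α) / ρ) + ∑' s, ENNReal.ofReal (weight r α β k x s * g s)

lemma measurable_relInterference {ι : Type} [Countable ι] (α ρ σ β : ℝ) (k : Fin K) :
    Measurable fun p : (Option ι × Fin K → ℝ) × (ι → Plane) =>
      relInterference r α ρ σ β k p.1 p.2 := by
  unfold relInterference
  refine Measurable.const_add (Measurable.tsum fun s => ?_) _
  exact (((measurable_weight α β k s).comp measurable_snd).mul
    ((measurable_pi_apply s).comp measurable_fst)).ennreal_ofReal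

lemma tsum_option_prod {ι : Type} (f : Option ι × Fin K → ℝ≥0∞) :
    ∑' s, f s = ∑ j, f (none, j) + ∑' i, ∑ j, f (some i, j) := by
  rw [ENNReal.tsum_prod', ← (Equiv.optionEquivSumPUnit.{0} ι).symm.tsum_eq,
    Summable.tsum_sum ENNReal.summable ENNReal.summable, add_comm]
  simp [tsum_fintype]

lemma sinr_le_iff (N : ZFNetwork M K B r lam) {α ρ σ β : ℝ} (hρ : 0 < ρ) (hβ : 0 < β) {k : Fin K}
    (hr : r k ≠ 0) {ω : N.Ω} (hω : ∀ s, 0 ≤ N.gain k s ω) :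
    N.sinr α ρ σ k ω ≤ ENNReal.ofReal β ↔ ENNReal.ofReal (N.gain k (none, k) ω) ≤
      relInterference r α ρ σ β k (fun s => N.gain k s ω) fun i => N.X i ω := by
  have hd : 0 < ‖r k‖ := norm_pos_iff.2 hr
  have hdα : 0 < ‖r k‖ ^ α := Real.rpow_pos_of_pos hd _
  have hdα' : 0 < ‖r k‖ ^ (-α) := Real.rpow_pos_of_pos hd _
  have hdd : ‖r k‖ ^ α * ‖r k‖ ^ (-α) = 1 := by
    rw [← Real.rpow_add hd, add_neg_cancel, Real.rpow_zero]
  set a : ℝ := ρ * ‖r k‖ ^ (-α) with ha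
  -- `a` is the mean signal power and `q` is `β / a`, the factor that normalizes interference and
  -- noise.
  set q : ℝ := β * ‖r k‖ ^ α / ρ with hq
  have ha0 : 0 < a := by positivity
  have hq0 : 0 < q := by positivity
  have haq : a * q = β := by
    rw [ha, hq]; field_simp; rw [mul_comm, hdd]
  have hrel : relInterference r α ρ σ β k (fun s => N.gain k s ω) (fun i => N.X i ω) =
      ENNReal.ofReal q *
        (N.interCluster α ρ k ω + N.intraCluster α ρ k ω + ENNReal.ofReal (σ ^ 2)) := by
    rw [relInterference, tsum_option_prod, mul_add, mul_add, interCluster, intraCluster,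
      ← ENNReal.tsum_mul_left, Finset.mul_sum]
    have h1 : ENNReal.ofReal (σ ^ 2 * (β * ‖r k‖ ^ α) / ρ) =
        ENNReal.ofReal q * ENNReal.ofReal (σ ^ 2) := by
      rw [← ENNReal.ofReal_mul hq0.le]; congr 1; rw [hq]; ring
    have h2 : ∀ i, ∑ j, ENNReal.ofReal (weight r α β k (fun i => N.X i ω) (some i, j) *
        N.gain k (some i, j) ω) = ENNReal.ofReal q * ENNReal.ofReal
          (ρ * (∑ j, N.gain k (some i, j) ω) * ‖N.X i ω - r k‖ ^ (-α)) := by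
      intro i
      rw [← ENNReal.ofReal_mul hq0.le, ← ENNReal.ofReal_sum_of_nonneg
        fun j _ => mul_nonneg (weight_nonneg hβ _ _ _) (hω _)]
      congr 1
      simp only [weight]
      rw [← Finset.mul_sum, hq]; field_simp
    have h3 : ∑ j, ENNReal.ofReal (weight r α β k (fun i => N.X i ω) (none, j) *
        N.gain k (none, j) ω) = ∑ j ∈ Finset.univ.erase k, ENNReal.ofReal q *
          ENNReal.ofReal (ρ * N.gain k (none, j) ω * ‖r k‖ ^ (-α)) := by
      rw [← Finset.add_sum_erase _ _ (Finset.mem_univ k)]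
      have h4 : weight r α β k (fun i => N.X i ω) (none, k) = 0 := if_pos rfl
      rw [h4, zero_mul, ENNReal.ofReal_zero, zero_add]
      refine Finset.sum_congr rfl fun j hj => ?_
      have h5 : weight r α β k (fun i => N.X i ω) (none, j) = β := if_neg (Finset.ne_of_mem_erase hj)
      rw [h5, ← ENNReal.ofReal_mul hq0.le, ← haq, ha]
      congr 1; ring
    simp_rw [h2]
    rw [h1, h3]
    ring
  have hsig : N.signal α ρ k ω = ENNReal.ofReal a * ENNReal.ofReal (N.gain k (none, k) ω) := by
    rw [signal, ← ENNReal.ofReal_mul ha0.le, ha]; congr 1; ring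
  -- As `β` is neither `0` nor `∞`, the denominator can be cleared even when it is `0` or `∞`.
  rw [sinr, ENNReal.div_le_iff_le_mul (Or.inr ENNReal.ofReal_ne_top)
    (Or.inr (ENNReal.ofReal_pos.2 hβ).ne'), hsig, hrel, ← haq, ENNReal.ofReal_mul ha0.le, mul_assoc,
    ENNReal.mul_le_mul_iff_right (ENNReal.ofReal_pos.2 ha0).ne' ENNReal.ofReal_ne_top]

lemma ae_nonneg_streamGainLaw (M B : ℕ) {ι : Type} (k : Fin K) (s : Option ι × Fin K) :
    ∀ᵐ x ∂streamGainLaw M B k s, 0 ≤ x := by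
  rcases s with ⟨_ | i, j⟩
  · simp only [streamGainLaw]
    split_ifs
    · exact ae_nonneg_unmatchedGainLaw M
    · exact ae_nonneg_leakageGainLaw M B
  · exact ae_nonneg_unmatchedGainLaw M

lemma ae_gain_nonneg (N : ZFNetwork M K B r lam) (k : Fin K) :
    ∀ᵐ ω ∂N.μ, ∀ s, 0 ≤ N.gain k s ω := by
  refine ae_all_iff.2 fun s => ?_
  have h := ae_nonneg_streamGainLaw M B k s
  rw [← (N.gain_law k s).map_eq] at h
  exact ae_of_ae_map (N.gain_law k s).aemeasurable h

lemma lintegral_expNeg_streamGainLaw (hKM : K ≤ M) {ι : Type} {α β : ℝ} (hβ : 0 < β) (k : Fin K)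
    (x : ι → Plane) (s : Option ι × Fin K) :
    ∫⁻ y, expNeg (ENNReal.ofReal (weight r α β k x s * y)) ∂streamGainLaw M B k s =
      expNeg (logWeight M B r α β k x s) := by
  have hM : 1 ≤ M := k.pos.trans_le hKM
  rcases s with ⟨_ | i, j⟩
  · simp only [weight, logWeight, streamGainLaw]
    split_ifs with hj
    · have := (unmatchedGainLaw_eq hM ▸ Measure.isProbabilityMeasure_map (by fun_prop) :
        IsProbabilityMeasure (unmatchedGainLaw M))
      simp [expNeg_zero]
    -- A second stream forces `K ≥ 2`, so `M ≥ 2` and the quantization law is a genuine one.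
    · have hM2 : 2 ≤ M := by
        have := Fin.val_ne_of_ne hj
        omega
      exact lintegral_expNeg_ofReal_mul (ae_nonneg_leakageGainLaw M B) hβ.le (quantDelta_pos M B).le
        (lintegral_exp_neg_leakageGainLaw hM2 B hβ.le)
  · simp only [weight, logWeight, streamGainLaw]
    have hw : 0 ≤ β * ‖r k‖ ^ α * ‖x i - r k‖ ^ (-α) := by positivity
    have := lintegral_expNeg_ofReal_mul (ae_nonneg_unmatchedGainLaw M) hw zero_le_one (by
      rw [mul_one]; exact lintegral_exp_neg_unmatchedGainLaw hM hw)
    rwa [mul_one] at this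

/-- The exponent of the success probability of a user at distance `d`, with `ζ = β d^α`. -/
def outageExponent (M K B : ℕ) (α ρ σ β ζ lam : ℝ) : ℝ :=
  σ ^ 2 * ζ / ρ + ((K : ℝ) - 1) * Real.log (1 + β * quantDelta M B) +
    lam * (interferenceConst K α * ζ ^ (2 / α))

/-- The event that the signal of user `k` exceeds `β` times the interference and noise. -/
def successEvent (N : ZFNetwork M K B r lam) (α ρ σ β : ℝ) (k : Fin K) : Set N.Ω :=
  {ω | relInterference r α ρ σ β k (fun s => N.gain k s ω) (fun i => N.X i ω) <
    ENNReal.ofReal (N.gain k (none, k) ω)}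

/-- The gains are independent of the points, so by Fubini the locations can be frozen. The weights
are then constants, and the exponential signal formula applies to the independent gains. -/
lemma measure_successEvent (N : ZFNetwork M K B r lam) (hKM : K ≤ M) {α ρ σ β : ℝ}
    (hβ : 0 < β) (k : Fin K) :
    N.μ (N.successEvent α ρ σ β k) =
      ∫⁻ ω, expNeg (ENNReal.ofReal (σ ^ 2 * (β * ‖r k‖ ^ α) / ρ) +
        ∑' s, logWeight M B r α β k (fun i => N.X i ω) s) ∂N.μ := by
  have hM : 1 ≤ M := k.pos.trans_le hKM
  have hgm : ∀ s, AEMeasurable (N.gain k s) N.μ := fun s => (N.gain_law k s).aemeasurable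
  have hG : AEMeasurable (fun ω s => N.gain k s ω) N.μ := aemeasurable_pi_iff.2 hgm
  have hX : Measurable (fun ω i => N.X i ω) := measurable_pi_lambda _ N.poisson.measurable
  have hpG := Measure.isProbabilityMeasure_map hG
  have hpX := Measure.isProbabilityMeasure_map (μ := N.μ) hX.aemeasurable
  set T : Set ((Option N.ι × Fin K → ℝ) × (N.ι → Plane)) :=
    {p | relInterference r α ρ σ β k p.1 p.2 < ENNReal.ofReal (p.1 (none, k))}
  have hT : MeasurableSet T := measurableSet_lt (measurable_relInterference α ρ σ β k)
    ((measurable_pi_apply _).comp measurable_fst).ennreal_ofReal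
  have hsec : ∀ x : N.ι → Plane, (N.μ.map fun ω s => N.gain k s ω) ((fun g => (g, x)) ⁻¹' T) =
      expNeg (ENNReal.ofReal (σ ^ 2 * (β * ‖r k‖ ^ α) / ρ) +
        ∑' s, logWeight M B r α β k x s) := by
    intro x
    have hlaw : ∀ s, (N.μ.map fun ω s => N.gain k s ω).map (fun y => y s) =
        streamGainLaw M B k s := fun s => by
      rw [AEMeasurable.map_map_of_aemeasurable (measurable_pi_apply s).aemeasurable hG]
      exact (N.gain_law k s).map_eq
    refine measure_add_tsum_lt_ofReal (g := fun s (y : Option N.ι × Fin K → ℝ) => y s)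
      (fun s => measurable_pi_apply s) (iIndepFun_eval_map hgm (N.gain_indep k))
      (none, k) _ (φ := fun s y => ENNReal.ofReal (weight r α β k x s * y))
      (fun s => by fun_prop) ?_ ?_ ?_
    · ext y
      simp [weight]
    · intro t ht
      rw [hlaw]
      simp only [streamGainLaw, if_pos]
      exact unmatchedGainLaw_Ioi hM ht
    · intro s
      rw [hlaw]
      exact lintegral_expNeg_streamGainLaw hKM hβ k x s
  have hmap : N.μ (N.successEvent α ρ σ β k) =
      N.μ.map (fun ω => ((fun s => N.gain k s ω), (fun i => N.X i ω))) T := by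
    rw [Measure.map_apply_of_aemeasurable (hG.prodMk hX.aemeasurable) hT]
    rfl
  rw [hmap, (indepFun_iff_map_prod_eq_prod_map_map hG hX.aemeasurable).1 (N.gain_indep_points k),
    Measure.prod_apply_symm hT, lintegral_map (measurable_measure_prodMk_right hT) hX]
  exact lintegral_congr fun ω => hsec _

/-- Noise and leakage exponents do not depend on the locations and factor out; the Laplace
functional handles the rest. -/
lemma lintegral_expNeg_logWeight (N : ZFNetwork M K B r lam) {α ρ σ β : ℝ} (hα : 2 < α)
    (hρ : 0 < ρ) (hβ : 0 < β) {k : Fin K} (hr : r k ≠ 0) :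
    ∫⁻ ω, expNeg (ENNReal.ofReal (σ ^ 2 * (β * ‖r k‖ ^ α) / ρ) +
        ∑' s, logWeight M B r α β k (fun i => N.X i ω) s) ∂N.μ =
      ENNReal.ofReal (Real.exp (-outageExponent M K B α ρ σ β (β * ‖r k‖ ^ α) lam)) := by
  have hd : 0 < ‖r k‖ := norm_pos_iff.2 hr
  have hζ : 0 < β * ‖r k‖ ^ α := mul_pos hβ (Real.rpow_pos_of_pos hd _)
  set ζ := β * ‖r k‖ ^ α
  have hδ := quantDelta_pos M B
  have hK : 1 ≤ K := k.pos
  have hK' : (0 : ℝ) ≤ (K : ℝ) - 1 := by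
    have : (1 : ℝ) ≤ K := by exact_mod_cast hK
    linarith
  have hlog : 0 ≤ Real.log (1 + β * quantDelta M B) :=
    Real.log_nonneg (by linarith [mul_pos hβ hδ])
  -- One equal summand for each of the `K` streams of an interferer, whence the power `K` in
  -- `hfexp`.
  set f : Plane → ℝ≥0∞ := fun y =>
    ∑ _j : Fin K, ENNReal.ofReal (Real.log (1 + ζ * ‖y - r k‖ ^ (-α)))
  have hf : Measurable f := by fun_prop
  have hnone : ∑ j : Fin K, (if j = k then (0 : ℝ≥0∞) else
      ENNReal.ofReal (Real.log (1 + β * quantDelta M B))) =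
      ENNReal.ofReal (((K : ℝ) - 1) * Real.log (1 + β * quantDelta M B)) := by
    rw [← Finset.add_sum_erase _ _ (Finset.mem_univ k), if_pos rfl, zero_add,
      Finset.sum_congr rfl fun j hj => if_neg (Finset.ne_of_mem_erase hj), Finset.sum_const,
      Finset.card_erase_of_mem (Finset.mem_univ k), Finset.card_univ, Fintype.card_fin,
      ← ENNReal.ofReal_nsmul, nsmul_eq_mul, Nat.cast_sub hK, Nat.cast_one]
  have hsum : ∀ ω, ∑' s, logWeight M B r α β k (fun i => N.X i ω) s =
      ENNReal.ofReal (((K : ℝ) - 1) * Real.log (1 + β * quantDelta M B)) + ∑' i, f (N.X i ω) := by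
    intro ω
    rw [tsum_option_prod, ← hnone]
    rfl
  have hfexp : ∀ y, 1 - expNeg (f y) =
      ENNReal.ofReal (1 - (1 + ζ * ‖y - r k‖ ^ (-α))⁻¹ ^ K) := by
    intro y
    have hw : 0 ≤ ζ * ‖y - r k‖ ^ (-α) := by positivity
    simp only [f]
    rw [expNeg_sum, Finset.prod_const, expNeg_log_one_add hw, Finset.card_univ, Fintype.card_fin,
      ENNReal.ofReal_sub _ (by positivity), ENNReal.ofReal_one, ENNReal.ofReal_pow (by positivity)]
  have hfm : Measurable fun ω => expNeg (∑' i, f (N.X i ω)) :=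
    measurable_expNeg.comp (Measurable.tsum fun i => hf.comp (N.poisson.measurable i))
  simp_rw [hsum, ← add_assoc]
  rw [← ENNReal.ofReal_add (by positivity) (by positivity)]
  simp_rw [expNeg_add]
  rw [lintegral_const_mul _ hfm, N.poisson.lintegral_expNeg hf]
  simp_rw [hfexp]
  have hI := interferenceConst_pos hK hα
  rw [lintegral_plane_interference K hα hζ, ← expNeg_add, ← ENNReal.ofReal_coe_nnreal,
    ← ENNReal.ofReal_mul lam.coe_nonneg, ← ENNReal.ofReal_add (by positivity) (by positivity),
    expNeg_ofReal (by positivity)]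
  rfl

lemma nullMeasurableSet_successEvent (N : ZFNetwork M K B r lam) (α ρ σ β : ℝ) (k : Fin K) :
    NullMeasurableSet (N.successEvent α ρ σ β k) N.μ := by
  have hgm : ∀ s, AEMeasurable (N.gain k s) N.μ := fun s => (N.gain_law k s).aemeasurable
  have hG : AEMeasurable (fun ω s => N.gain k s ω) N.μ := aemeasurable_pi_iff.2 hgm
  have hX : Measurable (fun ω i => N.X i ω) := measurable_pi_lambda _ N.poisson.measurable
  have h1 := (measurable_relInterference (r := r) α ρ σ β k).comp_aemeasurable
    (hG.prodMk hX.aemeasurable)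
  have h2 := (hgm (none, k)).ennreal_ofReal
  exact nullMeasurableSet_lt h1 h2

lemma outage_eq_real_compl (N : ZFNetwork M K B r lam) {α ρ σ β : ℝ} (hρ : 0 < ρ) (hβ : 0 < β)
    {k : Fin K} (hr : r k ≠ 0) :
    N.outage α ρ σ β k = N.μ.real (N.successEvent α ρ σ β k)ᶜ := by
  refine measureReal_congr (Filter.eventuallyEq_set.2 ?_)
  -- The laws make the gains nonnegative only almost surely, so the two events agree up to a null
  -- set.
  filter_upwards [N.ae_gain_nonneg k] with ω hω
  exact (N.sinr_le_iff hρ hβ hr hω).trans not_lt.symm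

/-- The outage probability in closed form. -/
lemma outage_eq (N : ZFNetwork M K B r lam) (hKM : K ≤ M) {α ρ σ β : ℝ} (hα : 2 < α)
    (hρ : 0 < ρ) (hβ : 0 < β) {k : Fin K} (hr : r k ≠ 0) :
    N.outage α ρ σ β k =
      1 - Real.exp (-outageExponent M K B α ρ σ β (β * ‖r k‖ ^ α) lam) := by
  rw [N.outage_eq_real_compl hρ hβ hr,
    probReal_compl_eq_one_sub₀ (N.nullMeasurableSet_successEvent α ρ σ β k), measureReal_def,
    N.measure_successEvent hKM hβ k, N.lintegral_expNeg_logWeight hα hρ hβ hr,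
    ENNReal.toReal_ofReal (Real.exp_pos _).le]

lemma outage_le_iff (N : ZFNetwork M K B r lam) (hKM : K ≤ M) {α ρ σ β ε : ℝ} (hα : 2 < α)
    (hρ : 0 < ρ) (hβ : 0 < β) (hε1 : ε < 1) {k : Fin K} (hr : r k ≠ 0) :
    N.outage α ρ σ β k ≤ ε ↔
      outageExponent M K B α ρ σ β (β * ‖r k‖ ^ α) lam ≤ Real.log (1 / (1 - ε)) := by
  have h1 : 0 < 1 - ε := by linarith
  rw [N.outage_eq hKM hα hρ hβ hr, one_div, Real.log_inv, sub_le_comm, ← Real.log_le_iff_le_exp h1,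
    le_neg]

lemma outageExponent_mono (M B : ℕ) {α ρ σ β lam ζ ζ' : ℝ} (hK : 1 ≤ K) (hα : 2 < α) (hρ : 0 < ρ)
    (hlam : 0 ≤ lam) (hζ : 0 ≤ ζ) (h : ζ ≤ ζ') :
    outageExponent M K B α ρ σ β ζ lam ≤ outageExponent M K B α ρ σ β ζ' lam := by
  have hI := interferenceConst_pos hK hα
  have : (0 : ℝ) ≤ 2 / α := by positivity
  unfold outageExponent
  gcongr

end ZFNetwork

/-! ### The maximum contention density and the capacity -/

theorem theorem2 (M K B : ℕ) (hK : 1 ≤ K) (hKM : K ≤ M) (r : Fin K → Plane) (hr : ∀ k, r k ≠ 0)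
    (α ρ σ β ε : ℝ) (hα : 2 < α) (hρ : 0 < ρ) (hβ : 0 < β) (hε0 : 0 < ε) (hε1 : ε < 1)
    (N : ∀ lam : ℝ≥0, ZFNetwork M K B r lam)
    (hfeas : 0 ≤ Real.log (1 / (1 - ε)) - σ ^ 2 * zetaMax r α β / ρ
      - ((K : ℝ) - 1) * Real.log (1 + β * quantDelta M B)) :
    IsGreatest (admissibleDensities N α ρ σ β ε) (maxContentionDensity N α ρ σ β ε) ∧
    transmissionCapacity N α ρ σ β ε =
      K * (1 - ε) / (interferenceConst K α * zetaMax r α β ^ (2 / α)) *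
        (Real.log (1 / (1 - ε)) - σ ^ 2 * zetaMax r α β / ρ
          - ((K : ℝ) - 1) * Real.log (1 + β * quantDelta M B)) := by
  have : Nonempty (Fin K) := ⟨⟨0, hK⟩⟩
  obtain ⟨k₀, hk₀⟩ := exists_eq_ciSup_of_finite (f := fun k => ‖r k‖)
  have hle : ∀ k, ‖r k‖ ≤ ‖r k₀‖ := fun k => hk₀ ▸ le_ciSup (f := fun k => ‖r k‖) (Set.finite_range _).bddAbove k
  have hζ : zetaMax r α β = β * ‖r k₀‖ ^ α := by rw [zetaMax, ← hk₀]
  have hζ0 : 0 < zetaMax r α β := by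
    rw [hζ]; exact mul_pos hβ (Real.rpow_pos_of_pos (norm_pos_iff.2 (hr k₀)) _)
  have hD : 0 < interferenceConst K α * zetaMax r α β ^ (2 / α) :=
    mul_pos (interferenceConst_pos hK hα) (Real.rpow_pos_of_pos hζ0 _)
  set D := interferenceConst K α * zetaMax r α β ^ (2 / α) with hDdef
  set slack := Real.log (1 / (1 - ε)) - σ ^ 2 * zetaMax r α β / ρ
    - ((K : ℝ) - 1) * Real.log (1 + β * quantDelta M B) with hslack
  -- The exponent increases with `ζ`, so the constraint of the farthest user `k₀` implies all
  -- others. It is affine in `lam` with slope `D > 0`; feasibility makes `slack / D` nonnegative, so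
  -- `toNNReal` truncates nothing.
  have hIic : admissibleDensities N α ρ σ β ε = Set.Iic (slack / D).toNNReal := by
    ext lam
    have h1 : lam ∈ admissibleDensities N α ρ σ β ε ↔ ZFNetwork.outageExponent M K B α ρ σ β
        (zetaMax r α β) lam ≤ Real.log (1 / (1 - ε)) := by
      rw [hζ]
      refine ⟨fun h => ((N lam).outage_le_iff hKM hα hρ hβ hε1 (hr k₀)).1 (h k₀), fun h k => ?_⟩
      refine ((N lam).outage_le_iff hKM hα hρ hβ hε1 (hr k)).2 (le_trans ?_ h)
      have hα0 : 0 ≤ α := by linarith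
      exact ZFNetwork.outageExponent_mono M B hK hα hρ lam.2 (by positivity)
        (mul_le_mul_of_nonneg_left (Real.rpow_le_rpow (norm_nonneg _) (hle k) hα0) hβ.le)
    rw [h1, Set.mem_Iic, Real.le_toNNReal_iff_coe_le (div_nonneg hfeas hD.le), le_div_iff₀ hD,
      ZFNetwork.outageExponent, ← hDdef, hslack]
    constructor <;> intro h <;> linarith
  have hmax : maxContentionDensity N α ρ σ β ε = (slack / D).toNNReal := by
    rw [maxContentionDensity, hIic, csSup_Iic]
  refine ⟨by rw [hmax, hIic]; exact isGreatest_Iic, ?_⟩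
  rw [transmissionCapacity, hmax, Real.coe_toNNReal _ (div_nonneg hfeas hD.le)]
  ring

end
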